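/- Let $d,n,b,\ell,m\ge 1$ be integers with $\ell\le d$. Let $f=\frac1n\sum_{i=1}^n f_i$, where each $f_i:\mathbb R^d\to\mathbb R$ is differentiable with $\|\nabla f_i(x)-\nabla f_i(y)\|\le L\|x-y\|$ for all $x,y$ ($L>0$), and let $h:\mathbb R^d\to(-\infty,+\infty]$ be convex and proximable, i.e. $\operatorname{prox}_{\gamma h}(x)=\operatorname{argmin}_y\{h(y)+\frac1{2\gamma}\|y-x\|^2\}$ exists for every $x\in\mathbb R^d$ and every $\gamma>0$. Let $F=f+h$, assume that $F$ attains its minimum, and fix $x_0^0\in\mathbb R^d$ with $h(x_0^0)<+\infty$, a stepsize $\gamma>0$ and discretization parameters $\beta_\tau>0$ ($\tau\in\mathbb N$). For $\beta>0$ and an orthogonal matrix $G\in O(d)$ put $$g(x,\beta)=\sum_{j=1}^d\frac{f(x+\beta e_j)-f(x)}{\beta}e_j,\qquad \hat g_i(x,G,\beta)=\frac d\ell\sum_{j=1}^{\ell}\frac{f_i(x+\beta Ge_j)-f_i(x)}{\beta}Ge_j .$$ Consider the algorithm which, for $\tau=0,1,2,\dots$ and $k=0,\dots,m-1$, samples indices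 $i^\tau_{1,k},\dots,i^\tau_{b,k}$ uniformly from $\{1,\dots,n\}$ and matrices $G^\tau_{1,k},\dots,G^\tau_{b,k}$ from the normalized Haar measure on $O(d)$, all of them mutually independent, and sets $$v_k^\tau=\frac1b\sum_{j=1}^b\Big(\hat g_{i^\tau_{j,k}}(x_k^\tau,G^\tau_{j,k},\beta_\tau)-\hat g_{i^\tau_{j,k}}(x_0^\tau,G^\tau_{j,k},\beta_\tau)\Big)+g(x_0^\tau,\beta_\tau),\qquad x_{k+1}^\tau=\operatorname{prox}_{\gamma h}(x_k^\tau-\gamma v_k^\tau),\qquad x_0^{\tau+1}=x_m^\tau .$$ Let $\mathcal G_\gamma(x)=\frac1\gamma\big(x-\operatorname{prox}_{\gamma h}(x-\gamma\nabla f(x))\big)$ and assume that, for some $\mu>0$, the revised Polyak–Łojasiewicz condition $\|\mathcal G_\gamma(x)\|^2\ge 2\mu\,(F(x)-\min F)$ holds for every $x$ with $F(x)<+\infty$. Put $\alpha=1-\frac{\gamma\mu}2$ and $\theta=1-\frac{\mu\gamma}2-\mu\gamma m$. If $$\gamma<\min\Big\{\frac1{4L},\ \frac2\mu\cdot\frac1{2m+1},\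 \frac{\sqrt{b\theta}}{10mL}\sqrt{\frac\ell d}\Big\},$$ then, for every $\tau\in\mathbb N$, $F(x_0^{\tau+1})$ is finite and integrable, and $$\mathbb E\big[F(x_0^{\tau+1})-\min F\big]\le\alpha^{m(\tau+1)}\Big(F(x_0^0)-\min F+\frac{1-\alpha^m}{1-\alpha}\,\gamma\Big[\frac{3L^2d^2}{\ell}+\frac{L^2d}2\Big]\sum_{i=0}^{\tau}\frac{\beta_i^2}{\alpha^{m(i+1)}}\Big).$$ -/

import Mathlib

open MeasureTheory ProbabilityTheory Gradient

namespace VRSZD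

/-- The Euclidean space `ℝᵈ`. -/
abbrev E (d : ℕ) : Type := EuclideanSpace ℝ (Fin d)

/-- The orthogonal group `O(d)` of real `d × d` matrices. -/
abbrev O (d : ℕ) : Type := Matrix.orthogonalGroup (Fin d) ℝ

/-- `O(d)` carries its Borel `σ`-algebra. -/
instance instMeasurableSpaceO (d : ℕ) : MeasurableSpace (O d) := borel (O d)

instance instBorelSpaceO (d : ℕ) : BorelSpace (O d) := ⟨rfl⟩

/-- The canonical basis vector `e_j` of `ℝᵈ`. -/
noncomputable def e {d : ℕ} (j : Fin d) : E d := EuclideanSpace.single j (1 : ℝ)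

section Objective

variable {d n : ℕ}

/-- The finite sum `f = (1/n) ∑ i, f_i`. -/
noncomputable def avg (f : Fin n → E d → ℝ) (x : E d) : ℝ := (1 / (n : ℝ)) * ∑ i, f i x

/-- The composite objective `F = f + h`; the convex part may take the value `+∞`
(for instance, it may be the indicator function of a convex set). -/
noncomputable def obj (f : Fin n → E d → ℝ) (h : E d → EReal) (x : E d) : EReal :=
  ((avg f x : ℝ) : EReal) + h x

/-- The value `min F` as a real number (meaningful when `F` attains its minimum at a point
where it is finite). -/
noncomputable def minObj (f : Fin n → E d → ℝ) (h : E d → EReal) : ℝ :=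
  (⨅ x, obj f h x).toReal

/-- A real function on `ℝᵈ` is `L`-smooth: differentiable with `L`-Lipschitz gradient. -/
def IsLSmooth (L : ℝ) (f : E d → ℝ) : Prop :=
  Differentiable ℝ f ∧ ∀ x y, ‖∇ f x - ∇ f y‖ ≤ L * ‖x - y‖

/-- Convexity of an extended-real-valued function which never takes the value `-∞`:
its epigraph is convex. -/
def IsConvexExt (h : E d → EReal) : Prop :=
  (∀ x, h x ≠ ⊥) ∧ Convex ℝ {p : E d × ℝ | h p.1 ≤ (p.2 : EReal)}

/-- `y` minimizes `z ↦ h z + ‖z - x‖² / (2γ)`. -/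
def IsProx (h : E d → EReal) (γ : ℝ) (x y : E d) : Prop :=
  ∀ z, h y + ((1 / (2 * γ) * ‖y - x‖ ^ 2 : ℝ) : EReal)
    ≤ h z + ((1 / (2 * γ) * ‖z - x‖ ^ 2 : ℝ) : EReal)

/-- `h` is proximable: `prox_{γ h}(x)` exists for every `x` and every `γ > 0`. -/
def IsProximable (h : E d → EReal) : Prop := ∀ (x : E d) (γ : ℝ), 0 < γ → ∃ y, IsProx h γ x y

/-- The proximal operator `prox_{γ h}(x)` (for a convex, proximable `h` that is not
identically `+∞` the minimizer exists and is unique). -/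
noncomputable def prox (h : E d → EReal) (γ : ℝ) (x : E d) : E d :=
  Classical.epsilon (IsProx h γ x)

/-- The gradient mapping `𝒢_γ(x) = (x - prox_{γ h}(x - γ ∇ f(x))) / γ`. -/
noncomputable def gradMap (f : Fin n → E d → ℝ) (h : E d → EReal) (γ : ℝ) (x : E d) : E d :=
  (1 / γ) • (x - prox h γ (x - γ • ∇ (avg f) x))

/-- The revised Polyak-Łojasiewicz inequality `‖𝒢_γ(x)‖² ≥ 2 μ (F(x) - min F)`, at every `x`
where `F` is finite. -/
def IsRPL (f : Fin n → E d → ℝ) (h : E d → EReal) (γ μ : ℝ) : Prop :=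
  ∀ x, obj f h x ≠ ⊤ → 2 * μ * ((obj f h x).toReal - minObj f h) ≤ ‖gradMap f h γ x‖ ^ 2

end Objective

section Algorithm

variable {d n b : ℕ}

/-- The full gradient surrogate
`g(x, β) = ∑_{j ≤ d} (f(x + β e_j) - f(x)) / β • e_j`. -/
noncomputable def fullSurrogate (f : Fin n → E d → ℝ) (β : ℝ) (x : E d) : E d :=
  ∑ j : Fin d, ((avg f (x + β • e j) - avg f x) / β) • e j

/-- The column `G e_j` of an orthogonal matrix. -/
noncomputable def col (G : O d) (j : Fin d) : E d :=
  Matrix.toEuclideanLin (G : Matrix (Fin d) (Fin d) ℝ) (e j)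

/-- The structured stochastic surrogate of the gradient of one component `φ = f_i`:
`ĝ(x, G, β) = (d/ℓ) ∑_{j ≤ ℓ} (φ(x + β G e_j) - φ(x)) / β • G e_j`, where the sum is over the
first `ℓ` canonical basis vectors. -/
noncomputable def stochSurrogate (φ : E d → ℝ) (ℓ : ℕ) (G : O d) (β : ℝ) (x : E d) : E d :=
  ((d : ℝ) / (ℓ : ℝ)) • ∑ j ∈ Finset.univ.filter (fun j : Fin d => j.val < ℓ),
    ((φ (x + β • col G j) - φ x) / β) • col G j

/-- The search direction at the point `x`, with reference point `y` (the outer iterate), sampled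
indices `I` and sampled orthogonal matrices `G`. -/
noncomputable def direction (f : Fin n → E d → ℝ) (ℓ : ℕ) (β : ℝ) (I : Fin b → Fin n)
    (G : Fin b → O d) (y x : E d) : E d :=
  (1 / (b : ℝ)) • (∑ j, (stochSurrogate (f (I j)) ℓ (G j) β x
    - stochSurrogate (f (I j)) ℓ (G j) β y)) + fullSurrogate f β y

/-- The inner loop started at `y`: `innerIter … y k` is the `k`-th inner iterate. Here `I k j`,
`G k j` is the `j`-th sample drawn at inner step `k`. -/
noncomputable def innerIter (f : Fin n → E d → ℝ) (h : E d → EReal) (γ : ℝ) (ℓ : ℕ) (β : ℝ)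
    (I : ℕ → Fin b → Fin n) (G : ℕ → Fin b → O d) (y : E d) : ℕ → E d
  | 0 => y
  | k + 1 =>
    prox h γ (innerIter f h γ ℓ β I G y k
      - γ • direction f ℓ β (I k) (G k) y (innerIter f h γ ℓ β I G y k))

/-- The outer iterates `x_0^τ`: `x_0^0 = x₀`, and `x_0^{τ+1} = x_m^τ` is the outcome of `m` inner
steps started at `x_0^τ` with discretization `β τ`. -/
noncomputable def outerIter (f : Fin n → E d → ℝ) (h : E d → EReal) (γ : ℝ) (ℓ m : ℕ)
    (β : ℕ → ℝ) (I : ℕ → ℕ → Fin b → Fin n) (G : ℕ → ℕ → Fin b → O d) (x₀ : E d) : ℕ → E d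
  | 0 => x₀
  | τ + 1 => innerIter f h γ ℓ (β τ) (I τ) (G τ) (outerIter f h γ ℓ m β I G x₀ τ) m

/-- The sampling scheme: for all `τ`, all `k < m` and all `j < b`, the index `I τ k j` is uniform
on `{1, …, n}`, the matrix `G τ k j` is uniform on `O(d)` (its law is the normalized Haar
measure), and all of these random variables are mutually independent. -/
structure IsSampling {Ω : Type*} [MeasurableSpace Ω] (P : Measure Ω) (m : ℕ)
    (I : ℕ → ℕ → Fin b → Ω → Fin n) (G : ℕ → ℕ → Fin b → Ω → O d) : Prop where
  measurable_index : ∀ (τ : ℕ) (k : Fin m) (j : Fin b), Measurable (I τ k j)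
  measurable_matrix : ∀ (τ : ℕ) (k : Fin m) (j : Fin b), Measurable (G τ k j)
  law_index : ∀ (τ : ℕ) (k : Fin m) (j : Fin b),
    P.map (I τ k j) = uniformOn (Set.univ : Set (Fin n))
  law_matrix : ∀ (τ : ℕ) (k : Fin m) (j : Fin b),
    (P.map (G τ k j)).IsHaarMeasure ∧ IsProbabilityMeasure (P.map (G τ k j))
  indep_pair : ∀ (τ : ℕ) (k : Fin m) (j : Fin b), IndepFun (I τ k j) (G τ k j) P
  indep : iIndepFun (fun (p : ℕ × Fin m × Fin b) (ω : Ω) =>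
    (I p.1 p.2.1 p.2.2 ω, G p.1 p.2.1 p.2.2 ω)) P

end Algorithm

end VRSZD

open VRSZD

/-! The proof is a Lyapunov argument over one epoch. Deterministically, an inexact proximal gradient
step contracts the gap `F - min F` by `α = 1 - γμ/2`, gains `-3/(8γ) ‖x_{k+1} - x_k‖²`, and pays
`γ/2` times the squared error of the direction (`gap_prox_le`).

That error splits into a discretization part, of order `β²` by smoothness, and a fluctuation: an
average of `b` independent random sketches of gradient differences, minus its mean. Haar invariance
makes each sketch unbiased with second moment `(d/ℓ)‖u‖²`, so the expected squared fluctuation is at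
most `d/(ℓb) · L² E‖x_k - x_0‖²` (`integral_norm_sq_fluctuation_traj_le`). The variance is thus
controlled by the distance travelled since the start of the epoch.

To absorb this distance, put `V_k = E[F(x_k) - min F + c(m-k)‖x_k - x_0‖²]` with `c = 3/(100 m² γ)`.
The weight decreases by `c` at each step; the stepsize bound makes this decrease pay for the
variance, for the growth in Young's inequality and for the factor `α`, while the gain `3/(8γ)` pays
for the new displacement (`lyapunov_weights`). Hence `V_{k+1} ≤ α V_k + B`. The extra term vanishes
at `k = 0` (zero distance) and at `k = m` (zero weight), so the recursion passes from epoch to epoch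
on the gap alone.

Measurability and integrability come from topology: the samples live in a compact space, and
iterates and objective values depend continuously on them, even though `h` is only convex and
proximable. -/

namespace VRSZD

/-! ### Smooth functions and their averages -/

section Smooth

variable {d n : ℕ} {L : ℝ}

/-- Along the segment, the deviation from the linearization has derivative at most `L t ‖v‖²` in
absolute value, so it stays below the primitive of that bound. Both signs are needed because `f` is
not assumed convex. -/
theorem IsLSmooth.abs_sub_sub_inner_le {φ : E d → ℝ} (hφ : IsLSmooth L φ) (x v : E d) :
    |φ (x + v) - φ x - inner ℝ (∇ φ x) v| ≤ L / 2 * ‖v‖ ^ 2 := by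
  have hderiv : ∀ t : ℝ, HasDerivAt (fun t : ℝ => φ (x + t • v) - φ x - t * inner ℝ (∇ φ x) v)
      (inner ℝ (∇ φ (x + t • v) - ∇ φ x) v) t := by
    intro t
    have h1 : HasDerivAt (fun t : ℝ => x + t • v) v t := by
      simpa using ((hasDerivAt_id t).smul_const v).const_add x
    have h2 := (hφ.1 (x + t • v)).hasGradientAt.hasFDerivAt.comp_hasDerivAt t h1
    have h3 := (h2.sub_const (φ x)).sub ((hasDerivAt_id t).mul_const (inner ℝ (∇ φ x) v))
    refine h3.congr_deriv ?_
    simp [inner_sub_left]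
  have hB : ∀ t : ℝ, HasDerivAt (fun t : ℝ => L / 2 * ‖v‖ ^ 2 * t ^ 2) (L * t * ‖v‖ ^ 2) t := by
    intro t
    refine (((hasDerivAt_id t).pow 2).const_mul (L / 2 * ‖v‖ ^ 2)).congr_deriv ?_
    simp
    ring
  have key := image_norm_le_of_norm_deriv_right_le_deriv_boundary (a := (0 : ℝ)) (b := 1)
    (fun t _ => (hderiv t).continuousAt.continuousWithinAt)
    (fun t _ => (hderiv t).hasDerivWithinAt) (by simp) hB
    (fun t ht => by
      calc ‖inner ℝ (∇ φ (x + t • v) - ∇ φ x) v‖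
          ≤ ‖∇ φ (x + t • v) - ∇ φ x‖ * ‖v‖ := norm_inner_le_norm _ _
        _ ≤ (L * ‖(x + t • v) - x‖) * ‖v‖ := by gcongr; exact hφ.2 _ _
        _ = L * t * ‖v‖ ^ 2 := by
          rw [add_sub_cancel_left, norm_smul, Real.norm_of_nonneg ht.1]; ring)
    (Set.right_mem_Icc.2 zero_le_one)
  simpa using key

theorem IsLSmooth.continuous {φ : E d → ℝ} (hφ : IsLSmooth L φ) : Continuous φ :=
  hφ.1.continuous

theorem IsLSmooth.continuous_gradient {φ : E d → ℝ} (hφ : IsLSmooth L φ) :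
    Continuous (∇ φ) := by
  have : LipschitzWith L.toNNReal (∇ φ) := by
    refine LipschitzWith.of_dist_le_mul fun x y => ?_
    rw [dist_eq_norm, dist_eq_norm]
    exact (hφ.2 x y).trans (by gcongr; exact Real.le_coe_toNNReal L)
  exact this.continuous

theorem hasGradientAt_avg {f : Fin n → E d → ℝ} (hf : ∀ i, IsLSmooth L (f i)) (x : E d) :
    HasGradientAt (avg f) ((1 / (n : ℝ)) • ∑ i, ∇ (f i) x) x := by
  have h1 : HasFDerivAt (fun x => ∑ i, f i x)
      (∑ i, InnerProductSpace.toDual ℝ (E d) (∇ (f i) x)) x :=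
    HasFDerivAt.fun_sum fun i _ => ((hf i).1 x).hasGradientAt.hasFDerivAt
  have h2 := h1.const_mul (1 / (n : ℝ))
  rw [hasGradientAt_iff_hasFDerivAt]
  refine h2.congr_fderiv ?_
  simp

theorem gradient_avg {f : Fin n → E d → ℝ} (hf : ∀ i, IsLSmooth L (f i)) (x : E d) :
    ∇ (avg f) x = (1 / (n : ℝ)) • ∑ i, ∇ (f i) x :=
  (hasGradientAt_avg hf x).gradient

theorem IsLSmooth.avg {f : Fin n → E d → ℝ} (hn : 0 < n) (hf : ∀ i, IsLSmooth L (f i)) :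
    IsLSmooth L (avg f) := by
  refine ⟨fun x => (hasGradientAt_avg hf x).differentiableAt, fun x y => ?_⟩
  have hn' : (0 : ℝ) < n := Nat.cast_pos.2 hn
  rw [gradient_avg hf, gradient_avg hf, ← smul_sub, ← Finset.sum_sub_distrib, norm_smul,
    Real.norm_of_nonneg (by positivity)]
  calc 1 / (n : ℝ) * ‖∑ i, (∇ (f i) x - ∇ (f i) y)‖
      ≤ 1 / (n : ℝ) * ∑ _i : Fin n, L * ‖x - y‖ := by
        gcongr
        exact norm_sum_le_of_le _ fun i _ => (hf i).2 x y
    _ = L * ‖x - y‖ := by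
        simp
        field_simp

end Smooth

/-! ### The proximal operator -/

section Prox

variable {d : ℕ} {h : E d → EReal} {γ : ℝ}

theorem isProx_prox (hprox : IsProximable h) (hγ : 0 < γ) (x : E d) :
    IsProx h γ x (prox h γ x) :=
  Classical.epsilon_spec (hprox x γ hγ)

theorem prox_ne_top (hprox : IsProximable h) (hγ : 0 < γ) {z : E d} (hz : h z ≠ ⊤) (x : E d) :
    h (prox h γ x) ≠ ⊤ := by
  intro htop
  have h1 := isProx_prox hprox hγ x z
  rw [htop, EReal.top_add_coe, top_le_iff] at h1
  exact EReal.add_ne_top hz (EReal.coe_ne_top _) h1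

theorem IsConvexExt.toReal_segment_le (hconv : IsConvexExt h) {x y : E d} (hx : h x ≠ ⊤)
    (hy : h y ≠ ⊤) {t : ℝ} (ht0 : 0 ≤ t) (ht1 : t ≤ 1) :
    h (x + t • (y - x)) ≤ (((1 - t) * (h x).toReal + t * (h y).toReal : ℝ) : EReal) := by
  have hmem : ∀ {z : E d}, h z ≠ ⊤ →
      (z, (h z).toReal) ∈ {p : E d × ℝ | h p.1 ≤ (p.2 : EReal)} := fun {z} hz => by
    simp [EReal.coe_toReal hz (hconv.1 z)]
  have h1 := hconv.2 (hmem hx) (hmem hy) (sub_nonneg.2 ht1) ht0 (by ring)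
  have h2 : x + t • (y - x) = (1 - t) • x + t • y := by module
  rw [h2]
  simpa using h1

/-- First-order optimality of the proximal point, without subgradients: comparing `p` with `p + t(z
- p)` and using convexity of `h`, a violation by `a` would force `a ≤ t c` for every small `t > 0`.
-/
theorem toReal_prox_le_add_inner (hconv : IsConvexExt h) (hprox : IsProximable h) (hγ : 0 < γ)
    (x : E d) {z : E d} (hz : h z ≠ ⊤) :
    (h (prox h γ x)).toReal
      ≤ (h z).toReal + 1 / γ * inner ℝ (prox h γ x - x) (z - prox h γ x) := by
  set p := prox h γ x with hp
  have hptop : h p ≠ ⊤ := prox_ne_top hprox hγ hz x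
  set c := 1 / (2 * γ) * ‖z - p‖ ^ 2 with hc
  have hc0 : 0 ≤ c := by positivity
  by_contra! hlt
  set a := (h p).toReal - ((h z).toReal + 1 / γ * inner ℝ (p - x) (z - p)) with ha
  have ha0 : 0 < a := sub_pos.2 hlt
  -- This value lies in `(0, 1]` and satisfies `t c < a`, which is the contradiction sought.
  set t := a / (a + c) with ht
  have ht0 : 0 < t := by positivity
  have ht1 : t ≤ 1 := by rw [ht, div_le_one (by positivity)]; linarith
  have h1 := isProx_prox hprox hγ x (p + t • (z - p))
  rw [← hp, ← EReal.coe_toReal hptop (hconv.1 p), ← EReal.coe_add] at h1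
  have h2 := h1.trans (add_le_add_left
    (hconv.toReal_segment_le hptop hz ht0.le ht1) _)
  rw [← EReal.coe_add, EReal.coe_le_coe_iff] at h2
  have h3 : ‖p + t • (z - p) - x‖ ^ 2
      = ‖p - x‖ ^ 2 + 2 * (t * inner ℝ (p - x) (z - p)) + t ^ 2 * ‖z - p‖ ^ 2 := by
    have : p + t • (z - p) - x = (p - x) + t • (z - p) := by abel
    rw [this, norm_add_sq_real, inner_smul_right, norm_smul, mul_pow, Real.norm_eq_abs, sq_abs]
  rw [h3] at h2
  have h4 : t * a ≤ t * (t * c) := by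
    rw [ha, hc]
    have : 1 / γ = 2 * (1 / (2 * γ)) := by field_simp
    rw [this]
    linarith
  have h5 : a ≤ t * c := le_of_mul_le_mul_left h4 ht0
  rw [ht, div_mul_eq_mul_div, le_div_iff₀ (by positivity)] at h5
  nlinarith

theorem toReal_prox_add_le (hconv : IsConvexExt h) (hprox : IsProximable h) (hγ : 0 < γ)
    (x : E d) {z : E d} (hz : h z ≠ ⊤) :
    (h (prox h γ x)).toReal + 1 / (2 * γ) * ‖prox h γ x - x‖ ^ 2
        + 1 / (2 * γ) * ‖z - prox h γ x‖ ^ 2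
      ≤ (h z).toReal + 1 / (2 * γ) * ‖z - x‖ ^ 2 := by
  have h1 := toReal_prox_le_add_inner hconv hprox hγ x hz
  have h2 : ‖z - x‖ ^ 2 = ‖prox h γ x - x‖ ^ 2
      + 2 * inner ℝ (prox h γ x - x) (z - prox h γ x) + ‖z - prox h γ x‖ ^ 2 := by
    rw [← norm_add_sq_real]
    congr 2
    abel
  have h3 : 1 / γ = 2 * (1 / (2 * γ)) := by field_simp
  rw [h2]
  rw [h3] at h1
  linarith

/-- Adding the optimality inequalities at the two proximal points cancels `h` and leaves `‖p - q‖² ≤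
⟨x - y, p - q⟩`; Cauchy-Schwarz concludes. -/
theorem norm_prox_sub_prox_le (hconv : IsConvexExt h) (hprox : IsProximable h) (hγ : 0 < γ)
    {x₀ : E d} (hx₀ : h x₀ ≠ ⊤) (x y : E d) :
    ‖prox h γ x - prox h γ y‖ ≤ ‖x - y‖ := by
  have h1 := toReal_prox_le_add_inner hconv hprox hγ x (prox_ne_top hprox hγ hx₀ y)
  have h2 := toReal_prox_le_add_inner hconv hprox hγ y (prox_ne_top hprox hγ hx₀ x)
  set p := prox h γ x
  set q := prox h γ y
  have h3 : 0 ≤ 1 / γ * (inner ℝ (p - x) (q - p) + inner ℝ (q - y) (p - q)) := by linarith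
  have h4 : 0 ≤ inner ℝ (p - x) (q - p) + inner ℝ (q - y) (p - q) :=
    nonneg_of_mul_nonneg_right h3 (by positivity)
  have h5 : inner ℝ (p - x) (q - p) + inner ℝ (q - y) (p - q)
      = inner ℝ (x - y) (p - q) - ‖p - q‖ ^ 2 := by
    rw [← real_inner_self_eq_norm_sq, ← inner_sub_left, ← neg_sub p q, inner_neg_right,
      ← inner_neg_left, ← inner_add_left]
    congr 1
    abel
  have h6 := real_inner_le_norm (x - y) (p - q)
  by_contra! hlt
  have h7 : 0 < ‖p - q‖ := (norm_nonneg _).trans_lt hlt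
  nlinarith

theorem continuous_prox (hconv : IsConvexExt h) (hprox : IsProximable h) (hγ : 0 < γ)
    {x₀ : E d} (hx₀ : h x₀ ≠ ⊤) : Continuous (prox h γ) := by
  have : LipschitzWith 1 (prox h γ) := LipschitzWith.of_dist_le_mul fun x y => by
    simpa [dist_eq_norm] using norm_prox_sub_prox_le hconv hprox hγ hx₀ x y
  exact this.continuous

/-- Although `h` itself need not be measurable, its values along the range of the proximal
operator depend continuously on the argument. -/
theorem continuous_toReal_prox (hconv : IsConvexExt h) (hprox : IsProximable h) (hγ : 0 < γ)
    {x₀ : E d} (hx₀ : h x₀ ≠ ⊤) : Continuous fun x => (h (prox h γ x)).toReal := by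
  have hp := continuous_prox hconv hprox hγ hx₀
  have key : ∀ x y, (h (prox h γ x)).toReal - (h (prox h γ y)).toReal
      ≤ 1 / (2 * γ) * (‖prox h γ y - x‖ ^ 2 - ‖prox h γ x - x‖ ^ 2) := fun x y => by
    have h1 := toReal_prox_add_le hconv hprox hγ x (prox_ne_top hprox hγ hx₀ y)
    have h2 : 0 ≤ 1 / (2 * γ) * ‖prox h γ y - prox h γ x‖ ^ 2 := by positivity
    linarith
  rw [continuous_iff_continuousAt]
  intro x
  refine tendsto_iff_dist_tendsto_zero.2 ?_
  -- Applying `key` in both orders bounds the increment on both sides by quantities that are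
  -- continuous in `y` and vanish at `y = x`.
  set u : E d → ℝ := fun y =>
    |1 / (2 * γ) * (‖prox h γ x - y‖ ^ 2 - ‖prox h γ y - y‖ ^ 2)|
      + |1 / (2 * γ) * (‖prox h γ y - x‖ ^ 2 - ‖prox h γ x - x‖ ^ 2)| with hu
  have hu0 : Filter.Tendsto u (nhds x) (nhds 0) := by
    have hcont : Continuous u := by
      rw [hu]
      fun_prop
    have := hcont.tendsto x
    simpa [hu] using this
  refine squeeze_zero (fun _ => dist_nonneg) (fun y => ?_) hu0
  rw [Real.dist_eq, abs_le]
  constructor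
  · have h1 := key x y
    have h2 := le_abs_self (1 / (2 * γ) * (‖prox h γ y - x‖ ^ 2 - ‖prox h γ x - x‖ ^ 2))
    have h3 := abs_nonneg (1 / (2 * γ) * (‖prox h γ x - y‖ ^ 2 - ‖prox h γ y - y‖ ^ 2))
    simp only [hu]
    linarith
  · have h1 := key y x
    have h2 := abs_nonneg (1 / (2 * γ) * (‖prox h γ y - x‖ ^ 2 - ‖prox h γ x - x‖ ^ 2))
    have h3 := le_abs_self (1 / (2 * γ) * (‖prox h γ x - y‖ ^ 2 - ‖prox h γ y - y‖ ^ 2))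
    simp only [hu]
    linarith

end Prox

/-! ### One inexact proximal gradient step -/

section Step

variable {d n : ℕ} {f : Fin n → E d → ℝ} {h : E d → EReal} {γ L μ : ℝ}

theorem obj_ne_top {x : E d} (hx : h x ≠ ⊤) : obj f h x ≠ ⊤ :=
  EReal.add_ne_top (EReal.coe_ne_top _) hx

theorem toReal_obj (hconv : IsConvexExt h) {x : E d} (hx : h x ≠ ⊤) :
    (obj f h x).toReal = avg f x + (h x).toReal := by
  rw [obj, EReal.toReal_add (EReal.coe_ne_top _) (EReal.coe_ne_bot _) hx (hconv.1 x),
    EReal.toReal_coe]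

/-- Progress of one inexact proximal gradient step towards an arbitrary comparison point. -/
theorem toReal_obj_prox_le (hf : IsLSmooth L (avg f)) (hconv : IsConvexExt h)
    (hprox : IsProximable h) (hγ : 0 < γ) (x v : E d) {z : E d} (hz : h z ≠ ⊤) :
    (obj f h (prox h γ (x - γ • v))).toReal
      ≤ (obj f h z).toReal
        + inner ℝ (prox h γ (x - γ • v) - z) (∇ (avg f) x - v)
        + (L / 2 - 1 / (2 * γ)) * ‖prox h γ (x - γ • v) - x‖ ^ 2
        + (L / 2 + 1 / (2 * γ)) * ‖z - x‖ ^ 2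
        - 1 / (2 * γ) * ‖z - prox h γ (x - γ • v)‖ ^ 2 := by
  have h1 := toReal_prox_add_le hconv hprox hγ (x - γ • v) hz
  rw [toReal_obj hconv (prox_ne_top hprox hγ hz _), toReal_obj hconv hz]
  set p := prox h γ (x - γ • v)
  -- The quadratic upper bound is needed at the new point `p`, the lower bound at the comparison
  -- point `z`.
  have h2 := (abs_le.1 (hf.abs_sub_sub_inner_le x (p - x))).2
  have h3 := (abs_le.1 (hf.abs_sub_sub_inner_le x (z - x))).1
  rw [add_sub_cancel] at h2 h3
  have h4 : ∀ w : E d, ‖w - (x - γ • v)‖ ^ 2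
      = ‖w - x‖ ^ 2 + 2 * γ * inner ℝ (w - x) v + ‖γ • v‖ ^ 2 := fun w => by
    have : w - (x - γ • v) = (w - x) + γ • v := by abel
    rw [this, norm_add_sq_real, inner_smul_right]
    ring
  rw [h4, h4] at h1
  have h5 : ∀ s : ℝ, 1 / (2 * γ) * (2 * γ * s) = s := fun s => by field_simp
  have h6 := h5 (inner ℝ (p - x) v)
  have h7 := h5 (inner ℝ (z - x) v)
  have h8 : inner ℝ (p - z) (∇ (avg f) x - v)
      = inner ℝ (∇ (avg f) x) (p - x) - inner ℝ (∇ (avg f) x) (z - x)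
        - (inner ℝ (p - x) v - inner ℝ (z - x) v) := by
    rw [← inner_sub_right, ← inner_sub_left, sub_sub_sub_cancel_right, inner_sub_right,
      real_inner_comm]
  rw [h8]
  linarith

/-- One inexact proximal gradient step contracts the optimality gap, up to the squared error of
the direction. -/
theorem gap_prox_le (hf : IsLSmooth L (avg f)) (hconv : IsConvexExt h)
    (hprox : IsProximable h) (hγ : 0 < γ) (hγL : 4 * L * γ ≤ 1) (hRPL : IsRPL f h γ μ)
    {x : E d} (hx : h x ≠ ⊤) (v : E d) :
    (obj f h (prox h γ (x - γ • v))).toReal - minObj f h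
      ≤ (1 - γ * μ / 2) * ((obj f h x).toReal - minObj f h)
        - 3 / (8 * γ) * ‖prox h γ (x - γ • v) - x‖ ^ 2
        + γ / 2 * ‖∇ (avg f) x - v‖ ^ 2 := by
  -- The exact step `q` is an intermediary: `h1` compares `p` with `q`, `h2` compares `q` with `x`,
  -- and `F(q)` cancels in the sum. Since `L ≤ 1/(4γ)`, this leaves at most `-1/(4γ)‖q - x‖²` and
  -- `-3/(8γ)‖p - x‖²`.
  set q := prox h γ (x - γ • ∇ (avg f) x) with hq
  have h1 := toReal_obj_prox_le hf hconv hprox hγ x v (prox_ne_top hprox hγ hx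
    (x - γ • ∇ (avg f) x))
  have h2 := toReal_obj_prox_le hf hconv hprox hγ x (∇ (avg f) x) hx
  rw [← hq] at h1 h2
  set p := prox h γ (x - γ • v)
  simp only [sub_self, inner_zero_right, norm_zero] at h2
  rw [norm_sub_rev x q] at h2
  have h3 := hRPL x (obj_ne_top hx)
  have h4 : ‖gradMap f h γ x‖ ^ 2 = (1 / γ) ^ 2 * ‖q - x‖ ^ 2 := by
    rw [gradMap, norm_smul, mul_pow, norm_sub_rev, Real.norm_eq_abs, sq_abs]
  rw [h4] at h3
  -- The Young weight is chosen so that `1/(2γ)‖q - p‖²` cancels the negative term of `h1` exactly.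
  have h5 : inner ℝ (p - q) (∇ (avg f) x - v)
      ≤ 1 / (2 * γ) * ‖q - p‖ ^ 2 + γ / 2 * ‖∇ (avg f) x - v‖ ^ 2 := by
    refine (real_inner_le_norm _ _).trans ?_
    rw [norm_sub_rev p q]
    have : 1 / (2 * γ) * ‖q - p‖ ^ 2 + γ / 2 * ‖∇ (avg f) x - v‖ ^ 2
        - ‖q - p‖ * ‖∇ (avg f) x - v‖
        = 1 / (2 * γ) * (‖q - p‖ - γ * ‖∇ (avg f) x - v‖) ^ 2 := by
      field_simp
      ring
    have h0 : 0 ≤ 1 / (2 * γ) * (‖q - p‖ - γ * ‖∇ (avg f) x - v‖) ^ 2 := by positivity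
    linarith
  have hL : L ≤ 1 / (4 * γ) := by
    rw [le_div_iff₀ (by positivity)]
    linarith
  have h6 : γ / 4 * ((1 / γ) ^ 2 * ‖q - x‖ ^ 2) = 1 / (4 * γ) * ‖q - x‖ ^ 2 := by
    field_simp
  have h7 : γ / 4 * (2 * μ * ((obj f h x).toReal - minObj f h))
      ≤ 1 / (4 * γ) * ‖q - x‖ ^ 2 := by
    rw [← h6]
    exact mul_le_mul_of_nonneg_left h3 (by positivity)
  have h8 : L * ‖q - x‖ ^ 2 ≤ 1 / (4 * γ) * ‖q - x‖ ^ 2 := by gcongr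
  have h9 : L * ‖p - x‖ ^ 2 ≤ 1 / (4 * γ) * ‖p - x‖ ^ 2 := by gcongr
  have e1 : 1 / (2 * γ) = 2 * (1 / (4 * γ)) := by field_simp; ring
  have e2 : 3 / (8 * γ) = 3 / 2 * (1 / (4 * γ)) := by field_simp; ring
  rw [e1] at h1 h2 h5
  rw [e2]
  nlinarith

end Step

/-! ### The orthogonal group and its columns -/

section Orthogonal

variable {d : ℕ}

/-- The group is closed and its entries are bounded by one. Compactness is what makes continuous
functions of the samples integrable. -/
instance compactSpace_orthogonal : CompactSpace (O d) := by
  refine isCompact_iff_compactSpace (s := (Matrix.orthogonalGroup (Fin d) ℝ :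
    Set (Matrix (Fin d) (Fin d) ℝ))).1 ?_
  have hK : IsCompact (Set.univ.pi fun _ : Fin d => Set.univ.pi fun _ : Fin d =>
      Set.Icc (-1 : ℝ) 1) :=
    isCompact_univ_pi fun _ => isCompact_univ_pi fun _ => isCompact_Icc
  have hc : IsClosed (Matrix.orthogonalGroup (Fin d) ℝ : Set (Matrix (Fin d) (Fin d) ℝ)) :=
    isClosed_unitary
  refine IsCompact.of_isClosed_subset hK hc fun G hG i _ j _ => ?_
  have := entry_norm_bound_of_unitary (𝕜 := ℝ) (U := G) hG i j
  exact abs_le.1 this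

instance secondCountableTopology_orthogonal : SecondCountableTopology (O d) :=
  haveI : SecondCountableTopology (Matrix (Fin d) (Fin d) ℝ) :=
    inferInstanceAs (SecondCountableTopology (Fin d → Fin d → ℝ))
  TopologicalSpace.Subtype.secondCountableTopology _

theorem col_apply (G : O d) (j a : Fin d) : col G j a = (G : Matrix (Fin d) (Fin d) ℝ) a j := by
  simp [col, e, Matrix.toEuclideanLin, Matrix.toLpLin_apply]

theorem sum_col_mul_col (G : O d) (j k : Fin d) :
    ∑ a, (G : Matrix (Fin d) (Fin d) ℝ) a j * (G : Matrix (Fin d) (Fin d) ℝ) a k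
      = if j = k then 1 else 0 := by
  have h := congrFun (congrFun (Matrix.mem_unitaryGroup_iff'.1 G.2) j) k
  simpa [Matrix.mul_apply, Matrix.one_apply, Matrix.star_apply] using h

theorem orthonormal_col (G : O d) : Orthonormal ℝ (col G) := by
  rw [orthonormal_iff_ite]
  intro j k
  rw [← sum_col_mul_col G j k, PiLp.inner_apply]
  simp [col_apply, mul_comm]

theorem norm_col (G : O d) (j : Fin d) : ‖col G j‖ = 1 := (orthonormal_col G).1 j

theorem norm_sq_sum_smul_col (G : O d) (s : Finset (Fin d)) (c : Fin d → ℝ) :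
    ‖∑ j ∈ s, c j • col G j‖ ^ 2 = ∑ j ∈ s, c j ^ 2 := by
  rw [← real_inner_self_eq_norm_sq, (orthonormal_col G).inner_sum]
  simp [sq]

theorem continuous_col (j : Fin d) : Continuous fun G : O d => col G j := by
  have h : Continuous fun G : O d => fun a => (G : Matrix (Fin d) (Fin d) ℝ) a j :=
    continuous_pi fun a => (continuous_subtype_val : Continuous fun G : O d =>
      (G : Matrix (Fin d) (Fin d) ℝ)).matrix_elem a j
  have h2 := (PiLp.continuous_toLp 2 fun _ : Fin d => ℝ).comp h
  refine h2.congr fun G => ?_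
  ext a
  simp [col_apply]

/-- The reflection changing the sign of the coordinate `a`. -/
def signFlip (a : Fin d) : O d :=
  ⟨Matrix.diagonal fun k => if k = a then -1 else 1, by
    rw [Matrix.mem_unitaryGroup_iff, Matrix.star_eq_conjTranspose, Matrix.diagonal_conjTranspose,
      Matrix.diagonal_mul_diagonal, ← Matrix.diagonal_one]
    congr 1
    ext k
    by_cases hk : k = a <;> simp [hk]⟩

theorem signFlip_mul_apply (a : Fin d) (G : O d) (i j : Fin d) :
    ((signFlip a * G : O d) : Matrix (Fin d) (Fin d) ℝ) i j
      = (if i = a then -1 else 1) * (G : Matrix (Fin d) (Fin d) ℝ) i j := by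
  simp [signFlip, Matrix.diagonal_mul]

/-- The orthogonal matrix permuting the coordinates by `σ`. -/
def permOrthogonal (σ : Equiv.Perm (Fin d)) : O d :=
  ⟨Matrix.of fun i k => if σ i = k then 1 else 0, by
    rw [Matrix.mem_unitaryGroup_iff]
    ext i j
    simp [Matrix.mul_apply, Matrix.one_apply, Matrix.star_apply, eq_comm]⟩

theorem permOrthogonal_mul_apply (σ : Equiv.Perm (Fin d)) (G : O d) (i j : Fin d) :
    ((permOrthogonal σ * G : O d) : Matrix (Fin d) (Fin d) ℝ) i j
      = (G : Matrix (Fin d) (Fin d) ℝ) (σ i) j := by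
  simp [permOrthogonal, Matrix.mul_apply]

end Orthogonal

/-! ### Haar moments and random sketches -/

section Haar

variable {d : ℕ} {ν : Measure (O d)} [IsProbabilityMeasure ν]

theorem integrable_of_continuous_compact {K : Type*} [TopologicalSpace K] [CompactSpace K]
    [MeasurableSpace K] [OpensMeasurableSpace K] {κ : Measure K} [IsFiniteMeasure κ]
    {φ : K → ℝ} (hφ : Continuous φ) : Integrable φ κ := by
  obtain ⟨C, hC⟩ := isCompact_univ.exists_bound_of_continuousOn hφ.continuousOn
  exact Integrable.of_bound hφ.measurable.aestronglyMeasurable C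
    (Filter.Eventually.of_forall fun x => hC x (Set.mem_univ x))

theorem continuous_entry (a j : Fin d) :
    Continuous fun G : O d => (G : Matrix (Fin d) (Fin d) ℝ) a j :=
  (continuous_subtype_val : Continuous fun G : O d =>
    (G : Matrix (Fin d) (Fin d) ℝ)).matrix_elem a j

/-- Invariance under a sign flip of row `a` kills the mixed moments. Invariance under row
permutations makes the `d` second moments equal, and they sum to one because columns are unit
vectors. -/
theorem integral_entry_mul_entry [ν.IsMulLeftInvariant] (j a a' : Fin d) :
    ∫ G : O d, (G : Matrix (Fin d) (Fin d) ℝ) a j * (G : Matrix (Fin d) (Fin d) ℝ) a' j ∂ν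
      = if a = a' then 1 / (d : ℝ) else 0 := by
  have hint : ∀ a a' : Fin d, Integrable (fun G : O d =>
      (G : Matrix (Fin d) (Fin d) ℝ) a j * (G : Matrix (Fin d) (Fin d) ℝ) a' j) ν :=
    fun a a' => integrable_of_continuous_compact
      ((continuous_entry a j).mul (continuous_entry a' j))
  split_ifs with haa
  · subst haa
    have hall : ∀ c : Fin d, ∫ G : O d,
        (G : Matrix (Fin d) (Fin d) ℝ) c j * (G : Matrix (Fin d) (Fin d) ℝ) c j ∂ν
        = ∫ G : O d,
          (G : Matrix (Fin d) (Fin d) ℝ) a j * (G : Matrix (Fin d) (Fin d) ℝ) a j ∂ν := by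
      intro c
      rw [← integral_mul_left_eq_self (μ := ν) _ (permOrthogonal (Equiv.swap c a))]
      simp [permOrthogonal_mul_apply]
    have hsum : ∑ c : Fin d, ∫ G : O d,
        (G : Matrix (Fin d) (Fin d) ℝ) c j * (G : Matrix (Fin d) (Fin d) ℝ) c j ∂ν = 1 := by
      rw [← integral_finsetSum _ fun c _ => hint c c]
      simp [sum_col_mul_col]
    simp only [hall, Finset.sum_const, Finset.card_univ, Fintype.card_fin, nsmul_eq_mul] at hsum
    have hd : (d : ℝ) ≠ 0 := by
      rintro h0
      simp [h0] at hsum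
    rw [eq_div_iff hd, mul_comm]
    exact hsum
  · have h := integral_mul_left_eq_self (μ := ν) (fun G : O d =>
      (G : Matrix (Fin d) (Fin d) ℝ) a j * (G : Matrix (Fin d) (Fin d) ℝ) a' j) (signFlip a)
    simp only [signFlip_mul_apply, if_true, if_neg (Ne.symm haa), one_mul, neg_mul,
      integral_neg] at h
    linarith

theorem inner_col (G : O d) (j : Fin d) (u : E d) :
    inner ℝ (col G j) u = ∑ a, u a * (G : Matrix (Fin d) (Fin d) ℝ) a j := by
  rw [PiLp.inner_apply]
  simp [col_apply]

theorem continuous_col_apply (j a : Fin d) : Continuous fun G : O d => col G j a := by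
  simpa only [col_apply] using continuous_entry a j

theorem continuous_inner_col (j : Fin d) (u : E d) :
    Continuous fun G : O d => (inner ℝ (col G j) u : ℝ) :=
  (continuous_col j).inner continuous_const

theorem integral_inner_col_mul [ν.IsMulLeftInvariant] (j a : Fin d) (u : E d) :
    ∫ G : O d, inner ℝ (col G j) u * col G j a ∂ν = u a / d := by
  have hint : ∀ c : Fin d, Integrable (fun G : O d => u c *
      ((G : Matrix (Fin d) (Fin d) ℝ) c j * (G : Matrix (Fin d) (Fin d) ℝ) a j)) ν :=
    fun c => (integrable_of_continuous_compact
      ((continuous_entry c j).mul (continuous_entry a j))).const_mul _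
  simp only [inner_col, col_apply, Finset.sum_mul, mul_assoc]
  rw [integral_finsetSum _ fun c _ => hint c]
  simp only [integral_const_mul, integral_entry_mul_entry]
  simp [div_eq_mul_inv]

theorem integral_inner_col_sq [ν.IsMulLeftInvariant] (j : Fin d) (u : E d) :
    ∫ G : O d, inner ℝ (col G j) u ^ 2 ∂ν = ‖u‖ ^ 2 / d := by
  have h : ∀ G : O d, inner ℝ (col G j) u ^ 2
      = ∑ a, u a * (inner ℝ (col G j) u * col G j a) := fun G => by
    rw [sq]
    nth_rewrite 2 [inner_col]
    rw [Finset.mul_sum]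
    exact Finset.sum_congr rfl fun a _ => by rw [col_apply]; ring
  have hint : ∀ a : Fin d, Integrable (fun G : O d =>
      u a * (inner ℝ (col G j) u * col G j a)) ν := fun a =>
    (integrable_of_continuous_compact
      ((continuous_inner_col j u).mul (continuous_col_apply j a))).const_mul _
  simp only [h]
  rw [integral_finsetSum _ fun a _ => hint a]
  simp only [integral_const_mul, integral_inner_col_mul]
  rw [EuclideanSpace.real_norm_sq_eq, Finset.sum_div]
  exact Finset.sum_congr rfl fun a _ => by ring

/-- The random sketch `(d/ℓ) ∑_{j ≤ ℓ} ⟨G e_j, u⟩ G e_j` of a vector `u`. -/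
noncomputable def sketch (ℓ : ℕ) (G : O d) (u : E d) : E d :=
  ((d : ℝ) / (ℓ : ℝ)) • ∑ j ∈ Finset.univ.filter (fun j : Fin d => j.val < ℓ),
    (inner ℝ (col G j) u : ℝ) • col G j

theorem card_filter_val_lt {ℓ : ℕ} (hℓd : ℓ ≤ d) :
    (Finset.univ.filter fun j : Fin d => j.val < ℓ).card = ℓ := by
  rw [Fin.card_filter_val_lt, min_eq_right hℓd]

theorem sketch_sub (ℓ : ℕ) (G : O d) (u w : E d) :
    sketch ℓ G (u - w) = sketch ℓ G u - sketch ℓ G w := by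
  simp only [sketch, inner_sub_right, sub_smul, Finset.sum_sub_distrib, smul_sub]

theorem continuous_sketch_comp {K : Type*} [TopologicalSpace K] {ℓ : ℕ}
    {G : K → O d} {u : K → E d} (hG : Continuous G)
    (hu : Continuous u) : Continuous fun κ => sketch ℓ (G κ) (u κ) := by
  have hcol : ∀ j, Continuous fun κ => col (G κ) j := fun j => (continuous_col j).comp hG
  have h1 : Continuous fun κ => ∑ j ∈ Finset.univ.filter (fun j : Fin d => j.val < ℓ),
      (inner ℝ (col (G κ) j) (u κ) : ℝ) • col (G κ) j :=
    continuous_finsetSum _ fun j _ => ((hcol j).inner (𝕜 := ℝ) hu).smul (hcol j)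
  exact h1.const_smul ((d : ℝ) / (ℓ : ℝ))

theorem continuous_sketch (ℓ : ℕ) (u : E d) : Continuous fun G : O d => sketch ℓ G u :=
  continuous_sketch_comp continuous_id continuous_const

theorem norm_sq_sketch (ℓ : ℕ) (G : O d) (u : E d) :
    ‖sketch ℓ G u‖ ^ 2 = ((d : ℝ) / ℓ) ^ 2 *
      ∑ j ∈ Finset.univ.filter (fun j : Fin d => j.val < ℓ), inner ℝ (col G j) u ^ 2 := by
  rw [sketch, norm_smul, mul_pow, norm_sq_sum_smul_col, Real.norm_eq_abs, sq_abs]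

theorem integral_sketch_apply [ν.IsMulLeftInvariant] {ℓ : ℕ} (hℓ : 1 ≤ ℓ) (hℓd : ℓ ≤ d)
    (u : E d) (a : Fin d) : ∫ G : O d, sketch ℓ G u a ∂ν = u a := by
  have hℓ' : (ℓ : ℝ) ≠ 0 := by positivity
  have hd' : (d : ℝ) ≠ 0 := by
    have : 0 < d := by omega
    positivity
  simp only [sketch, PiLp.smul_apply, WithLp.ofLp_sum, Finset.sum_apply, smul_eq_mul]
  have hint : ∀ j : Fin d, Integrable (fun G : O d => inner ℝ (col G j) u * col G j a) ν :=
    fun j => integrable_of_continuous_compact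
      ((continuous_inner_col j u).mul (continuous_col_apply j a))
  rw [integral_const_mul, integral_finsetSum _ fun j _ => hint j]
  simp only [integral_inner_col_mul, Finset.sum_const, card_filter_val_lt hℓd, nsmul_eq_mul]
  field_simp

/-- Orthonormality of the columns removes cross terms pointwise; the `ℓ` remaining terms each have
mean `‖u‖²/d`, and `(d/ℓ)² · ℓ/d = d/ℓ`. -/
theorem integral_norm_sq_sketch [ν.IsMulLeftInvariant] {ℓ : ℕ} (hℓ : 1 ≤ ℓ) (hℓd : ℓ ≤ d)
    (u : E d) : ∫ G : O d, ‖sketch ℓ G u‖ ^ 2 ∂ν = (d : ℝ) / ℓ * ‖u‖ ^ 2 := by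
  have hℓ' : (ℓ : ℝ) ≠ 0 := by positivity
  have hd' : (d : ℝ) ≠ 0 := by
    have : 0 < d := by omega
    positivity
  simp only [norm_sq_sketch]
  have hint : ∀ j : Fin d, Integrable (fun G : O d => inner ℝ (col G j) u ^ 2) ν :=
    fun j => integrable_of_continuous_compact ((continuous_inner_col j u).pow 2)
  rw [integral_const_mul, integral_finsetSum _ fun j _ => hint j]
  simp only [integral_inner_col_sq, Finset.sum_const, card_filter_val_lt hℓd, nsmul_eq_mul]
  field_simp

end Haar

/-! ### Discretization error of the surrogates -/

section Surrogate

variable {d n b : ℕ} {L : ℝ}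

/-- Each directional difference quotient is within `Lβ/2` of the derivative, and orthonormality
turns the squared norm into a sum: `(d/ℓ)² · ℓ · (Lβ/2)²`. -/
theorem norm_sq_stochSurrogate_sub_sketch_le {φ : E d → ℝ} (hφ : IsLSmooth L φ)
    {ℓ : ℕ} (hℓ : 1 ≤ ℓ) (hℓd : ℓ ≤ d) (G : O d) {β : ℝ} (hβ : 0 < β) (x : E d) :
    ‖stochSurrogate φ ℓ G β x - sketch ℓ G (∇ φ x)‖ ^ 2
      ≤ (d : ℝ) ^ 2 * L ^ 2 * β ^ 2 / (4 * ℓ) := by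
  have h1 : stochSurrogate φ ℓ G β x - sketch ℓ G (∇ φ x)
      = ((d : ℝ) / ℓ) • ∑ j ∈ Finset.univ.filter (fun j : Fin d => j.val < ℓ),
        ((φ (x + β • col G j) - φ x) / β - inner ℝ (col G j) (∇ φ x)) • col G j := by
    simp only [stochSurrogate, sketch, sub_smul, Finset.sum_sub_distrib, smul_sub]
  rw [h1, norm_smul, mul_pow, norm_sq_sum_smul_col, Real.norm_eq_abs, sq_abs]
  have h2 : ∀ j ∈ Finset.univ.filter (fun j : Fin d => j.val < ℓ),
      ((φ (x + β • col G j) - φ x) / β - inner ℝ (col G j) (∇ φ x)) ^ 2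
        ≤ (L / 2 * β) ^ 2 := fun j _ => by
    refine sq_le_sq' ?_ ?_ <;>
    · have h3 := abs_le.1 (hφ.abs_sub_sub_inner_le x (β • col G j))
      rw [norm_smul, norm_col, mul_one, Real.norm_of_nonneg hβ.le, inner_smul_right,
        real_inner_comm] at h3
      have h4 : (φ (x + β • col G j) - φ x) / β - inner ℝ (col G j) (∇ φ x)
          = (φ (x + β • col G j) - φ x - β * inner ℝ (col G j) (∇ φ x)) / β := by
        field_simp
      rw [h4]
      first
      | rw [div_le_iff₀ hβ]; linarith [h3.2]
      | rw [le_div_iff₀ hβ]; linarith [h3.1]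
  calc ((d : ℝ) / ℓ) ^ 2 * ∑ j ∈ Finset.univ.filter (fun j : Fin d => j.val < ℓ),
        ((φ (x + β • col G j) - φ x) / β - inner ℝ (col G j) (∇ φ x)) ^ 2
      ≤ ((d : ℝ) / ℓ) ^ 2 * ∑ _j ∈ Finset.univ.filter (fun j : Fin d => j.val < ℓ),
        (L / 2 * β) ^ 2 := by
        refine mul_le_mul_of_nonneg_left (Finset.sum_le_sum h2) (by positivity)
    _ = (d : ℝ) ^ 2 * L ^ 2 * β ^ 2 / (4 * ℓ) := by
        rw [Finset.sum_const, card_filter_val_lt hℓd, nsmul_eq_mul]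
        field_simp
        ring

theorem norm_sq_fullSurrogate_sub_gradient_le {f : Fin n → E d → ℝ} (hf : IsLSmooth L (avg f))
    {β : ℝ} (hβ : 0 < β) (x : E d) :
    ‖fullSurrogate f β x - ∇ (avg f) x‖ ^ 2 ≤ d * L ^ 2 * β ^ 2 / 4 := by
  rw [EuclideanSpace.real_norm_sq_eq]
  have h2 : ∀ a : Fin d, (fullSurrogate f β x - ∇ (avg f) x) a ^ 2 ≤ (L / 2 * β) ^ 2 := by
    intro a
    have h3 := abs_le.1 (hf.abs_sub_sub_inner_le x (β • e a))
    have h5 : (fullSurrogate f β x - ∇ (avg f) x) a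
        = (avg f (x + β • e a) - avg f x) / β - ∇ (avg f) x a := by
      simp [fullSurrogate, e, Pi.single_apply]
    have h6 : (inner ℝ (∇ (avg f) x) (e a) : ℝ) = ∇ (avg f) x a := by
      simp only [e, EuclideanSpace.inner_single_right]
      simp
    have h7 : ‖(e a : E d)‖ = 1 := by simp [e]
    rw [norm_smul, h7, mul_one, Real.norm_of_nonneg hβ.le, inner_smul_right, h6] at h3
    have h4 : (avg f (x + β • e a) - avg f x) / β - ∇ (avg f) x a
        = (avg f (x + β • e a) - avg f x - β * ∇ (avg f) x a) / β := by
      field_simp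
    rw [h5, h4]
    refine sq_le_sq' ?_ ?_
    · rw [le_div_iff₀ hβ]
      linarith [h3.1]
    · rw [div_le_iff₀ hβ]
      linarith [h3.2]
  calc ∑ a : Fin d, (fullSurrogate f β x - ∇ (avg f) x) a ^ 2
      ≤ ∑ _a : Fin d, (L / 2 * β) ^ 2 := Finset.sum_le_sum fun a _ => h2 a
    _ = d * L ^ 2 * β ^ 2 / 4 := by
        rw [Finset.sum_const, Finset.card_univ, Fintype.card_fin, nsmul_eq_mul]
        ring

/-- The fluctuation of the averaged sketches of the vectors `u i` around the mean of `u`. -/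
noncomputable def fluctuation (ℓ : ℕ) (u : Fin n → E d) (s : Fin b → Fin n × O d) : E d :=
  (1 / (b : ℝ)) • ∑ j, sketch ℓ (s j).2 (u (s j).1) - (1 / (n : ℝ)) • ∑ i, u i

theorem norm_add_add_sq_le {V : Type*} [SeminormedAddCommGroup V] (x y z : V) :
    ‖x + y + z‖ ^ 2 ≤ 3 * ‖x‖ ^ 2 + 3 * ‖y‖ ^ 2 + 3 * ‖z‖ ^ 2 := by
  have h := norm_add₃_le (a := x) (b := y) (c := z)
  have h0 := norm_nonneg (x + y + z)
  nlinarith [sq_nonneg (‖x‖ - ‖y‖), sq_nonneg (‖x‖ - ‖z‖), sq_nonneg (‖y‖ - ‖z‖)]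

/-- Error of the search direction in terms of the fluctuation of sketched gradient
differences and of the discretization. -/
theorem norm_sq_gradient_sub_direction_le {f : Fin n → E d → ℝ} (hn : 0 < n) (hb : 0 < b)
    (hf : ∀ i, IsLSmooth L (f i)) (hL : 0 ≤ L) {ℓ : ℕ} (hℓ : 1 ≤ ℓ) (hℓd : ℓ ≤ d) {β : ℝ}
    (hβ : 0 < β) (s : Fin b → Fin n × O d) (y x : E d) :
    ‖∇ (avg f) x - direction f ℓ β (fun j => (s j).1) (fun j => (s j).2) y x‖ ^ 2
      ≤ 3 * ‖fluctuation ℓ (fun i => ∇ (f i) x - ∇ (f i) y) s‖ ^ 2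
        + (6 * L ^ 2 * d ^ 2 / ℓ + L ^ 2 * d) * β ^ 2 := by
  have hb' : (0 : ℝ) < b := Nat.cast_pos.2 hb
  have hℓ' : (0 : ℝ) < ℓ := Nat.cast_pos.2 hℓ
  set r : Fin b → E d → E d := fun j z =>
    stochSurrogate (f (s j).1) ℓ (s j).2 β z - sketch ℓ (s j).2 (∇ (f (s j).1) z) with hr
  set κ : ℝ := (d : ℝ) * L * β / (2 * √ℓ) with hκ
  have hκ0 : 0 ≤ κ := by positivity
  have hκ2 : κ ^ 2 = (d : ℝ) ^ 2 * L ^ 2 * β ^ 2 / (4 * ℓ) := by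
    rw [hκ, div_pow, mul_pow, mul_pow, mul_pow, Real.sq_sqrt hℓ'.le]
    norm_num
  have hrle : ∀ j z, ‖r j z‖ ≤ κ := fun j z => by
    refine le_of_sq_le_sq ?_ hκ0
    rw [hκ2]
    exact norm_sq_stochSurrogate_sub_sketch_le (hf _) hℓ hℓd _ hβ z
  -- Three error sources: the sampling fluctuation, the stochastic discretization errors at `x` and
  -- `y`, and the discretization of the full gradient at `y`.
  have hdecomp : direction f ℓ β (fun j => (s j).1) (fun j => (s j).2) y x - ∇ (avg f) x
      = fluctuation ℓ (fun i => ∇ (f i) x - ∇ (f i) y) s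
        + (1 / (b : ℝ)) • ∑ j, (r j x - r j y) + (fullSurrogate f β y - ∇ (avg f) y) := by
    have hsum : ∑ j, (stochSurrogate (f (s j).1) ℓ (s j).2 β x
        - stochSurrogate (f (s j).1) ℓ (s j).2 β y)
        = ∑ j, sketch ℓ (s j).2 (∇ (f (s j).1) x - ∇ (f (s j).1) y)
          + ∑ j, (r j x - r j y) := by
      rw [← Finset.sum_add_distrib]
      refine Finset.sum_congr rfl fun j _ => ?_
      rw [sketch_sub]
      simp only [hr]
      abel
    have hmean : (1 / (n : ℝ)) • ∑ i, (∇ (f i) x - ∇ (f i) y) = ∇ (avg f) x - ∇ (avg f) y := by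
      rw [gradient_avg hf, gradient_avg hf, Finset.sum_sub_distrib, smul_sub]
    rw [direction, fluctuation, hsum, hmean, smul_add]
    abel
  have hB : ‖(1 / (b : ℝ)) • ∑ j, (r j x - r j y)‖ ^ 2 ≤ (2 * κ) ^ 2 := by
    gcongr
    rw [norm_smul, Real.norm_of_nonneg (by positivity)]
    calc 1 / (b : ℝ) * ‖∑ j, (r j x - r j y)‖ ≤ 1 / (b : ℝ) * ∑ _j : Fin b, 2 * κ := by
          gcongr
          refine norm_sum_le_of_le _ fun j _ => (norm_sub_le _ _).trans ?_
          linarith [hrle j x, hrle j y]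
      _ = 2 * κ := by
          simp
          field_simp
  have hC := norm_sq_fullSurrogate_sub_gradient_le (IsLSmooth.avg hn hf) hβ y
  rw [norm_sub_rev, hdecomp]
  refine (norm_add_add_sq_le _ _ _).trans ?_
  rw [mul_pow, hκ2] at hB
  have e1 : (2 : ℝ) ^ 2 * ((d : ℝ) ^ 2 * L ^ 2 * β ^ 2 / (4 * ℓ))
      = L ^ 2 * d ^ 2 / ℓ * β ^ 2 := by
    field_simp
    ring
  have e2 : 6 * L ^ 2 * (d : ℝ) ^ 2 / ℓ = 6 * (L ^ 2 * d ^ 2 / ℓ) := by ring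
  rw [e1] at hB
  rw [e2]
  have p1 : 0 ≤ L ^ 2 * (d : ℝ) ^ 2 / ℓ * β ^ 2 := by positivity
  have p2 : 0 ≤ (d : ℝ) * L ^ 2 * β ^ 2 := by positivity
  -- The decomposition gives the constants `3` and `3/4`; they are relaxed to `6` and `1`.
  linarith

end Surrogate

/-! ### Expectations over independent samples -/

section Independence

variable {Ω : Type*} [MeasurableSpace Ω] {P : Measure Ω} [IsProbabilityMeasure P]

theorem integrable_comp_of_continuous_compact {K : Type*} [TopologicalSpace K] [CompactSpace K]
    [MeasurableSpace K] [OpensMeasurableSpace K] {Z : Ω → K} (hZ : Measurable Z)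
    {φ : K → ℝ} (hφ : Continuous φ) : Integrable (fun ω => φ (Z ω)) P := by
  have := Measure.isProbabilityMeasure_map (μ := P) hZ.aemeasurable
  exact (integrable_of_continuous_compact (κ := P.map Z) hφ).comp_measurable hZ

/-- If, for every frozen value of `Y`, the expectation of `Φ` in the independent variable `C` is
at most `ψ`, then the expectation of `Φ (Y, C)` is at most that of `ψ Y`. -/
theorem integral_comp_le_of_indepFun {α κ : Type*} [TopologicalSpace α] [CompactSpace α]
    [MeasurableSpace α] [OpensMeasurableSpace α] [TopologicalSpace κ] [CompactSpace κ]
    [MeasurableSpace κ] [OpensMeasurableSpace κ] [SecondCountableTopology κ]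
    {Y : Ω → α} {C : Ω → κ} (hY : Measurable Y) (hC : Measurable C) (hYC : IndepFun Y C P)
    {Φ : α × κ → ℝ} (hΦ : Continuous Φ) {ψ : α → ℝ} (hψ : Continuous ψ)
    (hle : ∀ y, ∫ ω, Φ (y, C ω) ∂P ≤ ψ y) :
    ∫ ω, Φ (Y ω, C ω) ∂P ≤ ∫ ω, ψ (Y ω) ∂P := by
  have := Measure.isProbabilityMeasure_map (μ := P) hY.aemeasurable
  have := Measure.isProbabilityMeasure_map (μ := P) hC.aemeasurable
  have hmap := (indepFun_iff_map_prod_eq_prod_map_map hY.aemeasurable hC.aemeasurable).1 hYC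
  have hint : Integrable Φ ((P.map Y).prod (P.map C)) := integrable_of_continuous_compact hΦ
  have h1 : ∫ ω, Φ (Y ω, C ω) ∂P = ∫ p, Φ p ∂((P.map Y).prod (P.map C)) := by
    rw [← hmap, integral_map (hY.prodMk hC).aemeasurable
      hΦ.measurable.aestronglyMeasurable]
  rw [h1, integral_prod _ hint, ← integral_map (f := ψ) hY.aemeasurable
    hψ.measurable.aestronglyMeasurable]
  refine integral_mono hint.integral_prod_left (integrable_of_continuous_compact hψ) fun y => ?_
  refine le_trans (le_of_eq ?_) (hle y)
  exact integral_map hC.aemeasurable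
    (hΦ.comp (Continuous.prodMk_right y)).measurable.aestronglyMeasurable

theorem integral_uniformOn_univ {n : ℕ} (φ : Fin n → ℝ) :
    ∫ i, φ i ∂(uniformOn (Set.univ : Set (Fin n))) = (1 / (n : ℝ)) * ∑ i, φ i := by
  rcases Nat.eq_zero_or_pos n with rfl | hn
  · rw [integral_fintype Integrable.of_finite]
    simp
  have : Nonempty (Fin n) := ⟨⟨0, hn⟩⟩
  rw [integral_fintype Integrable.of_finite, Finset.mul_sum]
  refine Finset.sum_congr rfl fun i _ => ?_
  rw [measureReal_def, uniformOn_univ]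
  simp

/-- The expectation of a function of a uniform index and an independent random matrix. -/
theorem integral_index_matrix {n d : ℕ} {i : Ω → Fin n} {G : Ω → O d}
    (hi : Measurable i) (hG : Measurable G) (hiG : IndepFun i G P)
    (hlaw : P.map i = uniformOn (Set.univ : Set (Fin n))) {φ : Fin n × O d → ℝ}
    (hφ : Continuous φ) :
    ∫ ω, φ (i ω, G ω) ∂P = (1 / (n : ℝ)) * ∑ k, ∫ g, φ (k, g) ∂(P.map G) := by
  have := Measure.isProbabilityMeasure_map (μ := P) hi.aemeasurable
  have := Measure.isProbabilityMeasure_map (μ := P) hG.aemeasurable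
  have hmap := (indepFun_iff_map_prod_eq_prod_map_map hi.aemeasurable hG.aemeasurable).1 hiG
  have hint : Integrable φ ((P.map i).prod (P.map G)) := integrable_of_continuous_compact hφ
  have h1 : ∫ ω, φ (i ω, G ω) ∂P = ∫ p, φ p ∂((P.map i).prod (P.map G)) := by
    rw [← hmap, integral_map (hi.prodMk hG).aemeasurable hφ.measurable.aestronglyMeasurable]
  rw [h1, integral_prod _ hint, hlaw, integral_uniformOn_univ]

theorem continuous_sketch_index {n d : ℕ} (ℓ : ℕ) (u : Fin n → E d) :
    Continuous fun s : Fin n × O d => sketch ℓ s.2 (u s.1) :=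
  continuous_prod_of_discrete_left.2 fun i => continuous_sketch ℓ (u i)

/-- Coordinatewise, the fluctuation is a centred average, since the sketch is unbiased and the index
uniform. Variances of independent terms add, each is at most the second moment, and summing over
coordinates recovers the sketch norm; `b` terms with factor `1/b²` give `1/b`. -/
theorem integral_norm_sq_fluctuation_le {n d b ℓ : ℕ} (hb : 0 < b) (hℓ : 1 ≤ ℓ) (hℓd : ℓ ≤ d)
    {I : Fin b → Ω → Fin n} {G : Fin b → Ω → O d}
    (hI : ∀ j, Measurable (I j)) (hG : ∀ j, Measurable (G j))
    (hIG : ∀ j, IndepFun (I j) (G j) P)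
    (hlaw : ∀ j, P.map (I j) = uniformOn (Set.univ : Set (Fin n)))
    (hhaar : ∀ j, (P.map (G j)).IsMulLeftInvariant)
    (hindep : iIndepFun (fun j ω => (I j ω, G j ω)) P) (u : Fin n → E d) :
    ∫ ω, ‖fluctuation ℓ u (fun j => (I j ω, G j ω))‖ ^ 2 ∂P
      ≤ (d : ℝ) / (ℓ * b) * ((1 / (n : ℝ)) * ∑ i, ‖u i‖ ^ 2) := by
  have hb' : (0 : ℝ) < b := Nat.cast_pos.2 hb
  have hprob : ∀ j, IsProbabilityMeasure (P.map (G j)) := fun j =>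
    Measure.isProbabilityMeasure_map (hG j).aemeasurable
  set ξ : Fin d → Fin b → Ω → ℝ := fun a j ω => sketch ℓ (G j ω) (u (I j ω)) a with hξ
  have hcoord : ∀ a : Fin d, Continuous fun s : Fin n × O d => sketch ℓ s.2 (u s.1) a :=
    fun a => (EuclideanSpace.proj a : E d →L[ℝ] ℝ).continuous.comp (continuous_sketch_index ℓ u)
  have hmeas : ∀ j, Measurable fun ω => (I j ω, G j ω) := fun j => (hI j).prodMk (hG j)
  have hint2 : ∀ a j, Integrable (fun ω => ξ a j ω ^ 2) P := fun a j =>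
    integrable_comp_of_continuous_compact (hmeas j) ((hcoord a).pow 2)
  have hξm : ∀ a j, AEStronglyMeasurable (ξ a j) P := fun a j =>
    ((hcoord a).measurable.comp (hmeas j)).aestronglyMeasurable
  have hL2 : ∀ a j, MemLp (ξ a j) 2 P := fun a j =>
    (memLp_two_iff_integrable_sq (hξm a j)).2 (hint2 a j)
  have hmean : ∀ a j, ∫ ω, ξ a j ω ∂P = (1 / (n : ℝ)) * ∑ i, u i a := fun a j => by
    have := hhaar j
    rw [show ∫ ω, ξ a j ω ∂P = _ from
      integral_index_matrix (hI j) (hG j) (hIG j) (hlaw j) (hcoord a)]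
    simp only [integral_sketch_apply hℓ hℓd]
  have hind : ∀ a, Pairwise fun i j => IndepFun (ξ a i) (ξ a j) P := fun a i j hij =>
    (hindep.indepFun hij).comp (hcoord a).measurable (hcoord a).measurable
  have hcoordle : ∀ a, ∫ ω, fluctuation ℓ u (fun j => (I j ω, G j ω)) a ^ 2 ∂P
      ≤ (1 / (b : ℝ)) ^ 2 * ∑ j, ∫ ω, ξ a j ω ^ 2 ∂P := fun a => by
    set S : Ω → ℝ := ∑ j, ξ a j with hS
    have hSmean : ∫ ω, S ω ∂P = b * ((1 / (n : ℝ)) * ∑ i, u i a) := by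
      simp only [hS, Finset.sum_apply]
      rw [integral_finsetSum _ fun j _ => (hL2 a j).integrable one_le_two]
      simp [hmean]
    have hSm : AEMeasurable S P := (Finset.aemeasurable_sum _ fun j _ => (hξm a j).aemeasurable)
    have hfl : ∀ ω, fluctuation ℓ u (fun j => (I j ω, G j ω)) a ^ 2
        = (1 / (b : ℝ)) ^ 2 * (S ω - ∫ ω, S ω ∂P) ^ 2 := fun ω => by
      rw [hSmean, ← mul_pow]
      congr 1
      simp only [fluctuation, PiLp.sub_apply, PiLp.smul_apply, WithLp.ofLp_sum,
        Finset.sum_apply, smul_eq_mul, hS, hξ]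
      field_simp
    simp only [hfl]
    rw [integral_const_mul, ← variance_eq_integral hSm, hS,
      IndepFun.variance_sum (fun j _ => hL2 a j) fun i _ j _ hij => hind a hij]
    gcongr with j
    exact variance_le_expectation_sq (hξm a j)
  have hnorm : ∀ j, ∑ a, ∫ ω, ξ a j ω ^ 2 ∂P
      = (d : ℝ) / ℓ * ((1 / (n : ℝ)) * ∑ i, ‖u i‖ ^ 2) := fun j => by
    have := hhaar j
    rw [← integral_finsetSum _ fun a _ => hint2 a j]
    have h1 : ∀ ω, ∑ a, ξ a j ω ^ 2 = ‖sketch ℓ (G j ω) (u (I j ω))‖ ^ 2 := fun ω => by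
      rw [EuclideanSpace.real_norm_sq_eq]
    simp only [h1]
    rw [integral_index_matrix (φ := fun s => ‖sketch ℓ s.2 (u s.1)‖ ^ 2) (hI j) (hG j) (hIG j)
      (hlaw j) ((continuous_sketch_index ℓ u).norm.pow 2)]
    simp only [integral_norm_sq_sketch hℓ hℓd, ← Finset.mul_sum]
    ring
  have hflint : ∀ a, Integrable
      (fun ω => fluctuation ℓ u (fun j => (I j ω, G j ω)) a ^ 2) P := fun a => by
    have hc : Continuous fun s : Fin b → Fin n × O d => fluctuation ℓ u s :=
      ((continuous_finsetSum _ fun j _ => (continuous_sketch_index ℓ u).comp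
        (continuous_apply j)).const_smul (1 / (b : ℝ))).sub continuous_const
    exact integrable_comp_of_continuous_compact
      (φ := fun s : Fin b → Fin n × O d => fluctuation ℓ u s a ^ 2) (measurable_pi_iff.2 hmeas)
      (((EuclideanSpace.proj a : E d →L[ℝ] ℝ).continuous.comp hc).pow 2)
  simp only [EuclideanSpace.real_norm_sq_eq (fluctuation _ _ _)]
  rw [integral_finsetSum _ fun a _ => hflint a]
  calc ∑ a, ∫ ω, fluctuation ℓ u (fun j => (I j ω, G j ω)) a ^ 2 ∂P
      ≤ ∑ a, (1 / (b : ℝ)) ^ 2 * ∑ j, ∫ ω, ξ a j ω ^ 2 ∂P :=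
        Finset.sum_le_sum fun a _ => hcoordle a
    _ = (1 / (b : ℝ)) ^ 2 * ∑ j, ∑ a, ∫ ω, ξ a j ω ^ 2 ∂P := by
        rw [← Finset.mul_sum, Finset.sum_comm]
    _ = (d : ℝ) / (ℓ * b) * ((1 / (n : ℝ)) * ∑ i, ‖u i‖ ^ 2) := by
        simp only [hnorm, Finset.sum_const, Finset.card_univ, Fintype.card_fin, nsmul_eq_mul]
        field_simp

end Independence

/-! ### The iterates as functions of the samples -/

section Trajectory

variable {d n b m : ℕ}

/-- The inner iterate `x_k^τ` as a function of all samples. -/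
noncomputable def traj (f : Fin n → E d → ℝ) (h : E d → EReal) (γ : ℝ) (ℓ m : ℕ) (β : ℕ → ℝ)
    (x₀ : E d) (z : ℕ → ℕ → Fin b → Fin n × O d) (τ k : ℕ) : E d :=
  innerIter f h γ ℓ (β τ) (fun k j => (z τ k j).1) (fun k j => (z τ k j).2)
    (outerIter f h γ ℓ m β (fun t k j => (z t k j).1) (fun t k j => (z t k j).2) x₀ τ) k

variable {f : Fin n → E d → ℝ} {h : E d → EReal} {γ L : ℝ} {ℓ : ℕ} {β : ℕ → ℝ} {x₀ : E d}

theorem traj_zero_zero (z : ℕ → ℕ → Fin b → Fin n × O d) :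
    traj f h γ ℓ m β x₀ z 0 0 = x₀ := rfl

theorem traj_succ_zero (z : ℕ → ℕ → Fin b → Fin n × O d) (τ : ℕ) :
    traj f h γ ℓ m β x₀ z (τ + 1) 0 = traj f h γ ℓ m β x₀ z τ m := rfl

theorem traj_succ (z : ℕ → ℕ → Fin b → Fin n × O d) (τ k : ℕ) :
    traj f h γ ℓ m β x₀ z τ (k + 1) = prox h γ (traj f h γ ℓ m β x₀ z τ k
      - γ • direction f ℓ (β τ) (fun j => (z τ k j).1) (fun j => (z τ k j).2)
        (traj f h γ ℓ m β x₀ z τ 0) (traj f h γ ℓ m β x₀ z τ k)) := rfl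

/-- The iterate `x_k^τ` depends only on the samples drawn before inner step `k` of epoch `τ`. -/
theorem traj_congr {z z' : ℕ → ℕ → Fin b → Fin n × O d} {τ k : ℕ} (hk : k ≤ m)
    (hz : ∀ t i j, i < m → (t < τ ∨ t = τ ∧ i < k) → z t i j = z' t i j) :
    traj f h γ ℓ m β x₀ z τ k = traj f h γ ℓ m β x₀ z' τ k := by
  induction τ generalizing k with
  | zero =>
    induction k with
    | zero => rfl
    | succ k ih =>
      have h1 := ih (by omega) fun t i j hi ht => hz t i j hi (by omega)
      have h2 : ∀ j, z 0 k j = z' 0 k j := fun j => hz 0 k j (by omega) (by omega)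
      simp only [traj_succ, traj_zero_zero, h1, h2]
  | succ τ ihτ =>
    have h0 : traj f h γ ℓ m β x₀ z (τ + 1) 0 = traj f h γ ℓ m β x₀ z' (τ + 1) 0 := by
      rw [traj_succ_zero, traj_succ_zero]
      exact ihτ le_rfl fun t i j hi ht => hz t i j hi (by omega)
    induction k with
    | zero => exact h0
    | succ k ih =>
      have h1 := ih (by omega) fun t i j hi ht => hz t i j hi (by omega)
      have h2 : ∀ j, z (τ + 1) k j = z' (τ + 1) k j := fun j => hz _ k j (by omega) (by omega)
      simp only [traj_succ _ (τ + 1) k, h0, h1, h2]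

theorem h_traj_ne_top (hprox : IsProximable h) (hγ : 0 < γ) (hx₀ : h x₀ ≠ ⊤)
    (z : ℕ → ℕ → Fin b → Fin n × O d) (τ k : ℕ) : h (traj f h γ ℓ m β x₀ z τ k) ≠ ⊤ := by
  have hs : ∀ τ k, h (traj f h γ ℓ m β x₀ z τ (k + 1)) ≠ ⊤ := fun τ k => by
    rw [traj_succ]
    exact prox_ne_top hprox hγ hx₀ _
  induction τ generalizing k with
  | zero =>
    cases k with
    | zero => exact hx₀
    | succ k => exact hs _ k
  | succ τ ih =>
    cases k with
    | zero => exact ih m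
    | succ k => exact hs _ k

section Continuity

variable {K : Type*} [TopologicalSpace K]

theorem continuous_comp_index {V : Type*} [TopologicalSpace V] {g : Fin n → E d → V}
    (hg : ∀ i, Continuous (g i)) {i : K → Fin n} {x : K → E d} (hi : Continuous i)
    (hx : Continuous x) : Continuous fun κ => g (i κ) (x κ) :=
  (continuous_prod_of_discrete_left (f := fun p : Fin n × E d => g p.1 p.2)).2 hg |>.comp
    (hi.prodMk hx)

theorem continuous_stochSurrogate (hf : ∀ i, Continuous (f i)) {β' : ℝ} {s : K → Fin n × O d}
    {x : K → E d} (hs : Continuous s) (hx : Continuous x) :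
    Continuous fun κ => stochSurrogate (f (s κ).1) ℓ (s κ).2 β' (x κ) := by
  have hcol : ∀ j, Continuous fun κ => col (s κ).2 j := fun j =>
    (continuous_col j).comp hs.snd
  have h1 : Continuous fun κ => ∑ j ∈ Finset.univ.filter (fun j : Fin d => j.val < ℓ),
      ((f (s κ).1 (x κ + β' • col (s κ).2 j) - f (s κ).1 (x κ)) / β') • col (s κ).2 j :=
    continuous_finsetSum _ fun j _ =>
      (((continuous_comp_index hf hs.fst (hx.add ((hcol j).const_smul β'))).sub
        (continuous_comp_index hf hs.fst hx)).div_const β').smul (hcol j)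
  exact h1.const_smul ((d : ℝ) / (ℓ : ℝ))

theorem continuous_avg (hf : ∀ i, Continuous (f i)) : Continuous (avg f) :=
  continuous_const.mul (continuous_finsetSum _ fun i _ => hf i)

theorem continuous_fullSurrogate (hf : ∀ i, Continuous (f i)) (β' : ℝ) :
    Continuous (fullSurrogate f β') :=
  continuous_finsetSum _ fun _ _ =>
    ((((continuous_avg hf).comp (continuous_id.add continuous_const)).sub
      (continuous_avg hf)).div_const β').smul continuous_const

theorem continuous_direction (hf : ∀ i, Continuous (f i)) {β' : ℝ}
    {s : K → Fin b → Fin n × O d} {y x : K → E d} (hs : ∀ j, Continuous fun κ => s κ j)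
    (hy : Continuous y) (hx : Continuous x) :
    Continuous fun κ => direction f ℓ β' (fun j => (s κ j).1) (fun j => (s κ j).2)
      (y κ) (x κ) := by
  have h1 : Continuous fun κ => ∑ j, (stochSurrogate (f (s κ j).1) ℓ (s κ j).2 β' (x κ)
      - stochSurrogate (f (s κ j).1) ℓ (s κ j).2 β' (y κ)) :=
    continuous_finsetSum _ fun j _ =>
      (continuous_stochSurrogate hf (hs j) hx).sub (continuous_stochSurrogate hf (hs j) hy)
  exact (h1.const_smul (1 / (b : ℝ))).add ((continuous_fullSurrogate hf β').comp hy)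

theorem continuous_fluctuation_gradient (hf : ∀ i, Continuous (∇ (f i)))
    {s : K → Fin b → Fin n × O d} {y x : K → E d} (hs : ∀ j, Continuous fun κ => s κ j)
    (hy : Continuous y) (hx : Continuous x) :
    Continuous fun κ => fluctuation ℓ (fun i => ∇ (f i) (x κ) - ∇ (f i) (y κ)) (s κ) := by
  have h1 : Continuous fun κ => ∑ j, sketch ℓ (s κ j).2
      (∇ (f (s κ j).1) (x κ) - ∇ (f (s κ j).1) (y κ)) :=
    continuous_finsetSum _ fun j _ => continuous_sketch_comp (hs j).snd
      ((continuous_comp_index hf (hs j).fst hx).sub (continuous_comp_index hf (hs j).fst hy))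
  have h2 : Continuous fun κ => ∑ i, (∇ (f i) (x κ) - ∇ (f i) (y κ)) :=
    continuous_finsetSum _ fun i _ => ((hf i).comp hx).sub ((hf i).comp hy)
  exact (h1.const_smul (1 / (b : ℝ))).sub (h2.const_smul (1 / (n : ℝ)))

theorem continuous_traj (hf : ∀ i, Continuous (f i)) (hconv : IsConvexExt h)
    (hprox : IsProximable h) (hγ : 0 < γ) (hx₀ : h x₀ ≠ ⊤)
    {z : K → ℕ → ℕ → Fin b → Fin n × O d} (hz : ∀ t i j, Continuous fun κ => z κ t i j)
    (τ k : ℕ) : Continuous fun κ => traj f h γ ℓ m β x₀ (z κ) τ k := by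
  have hs : ∀ τ, (Continuous fun κ => traj f h γ ℓ m β x₀ (z κ) τ 0) →
      ∀ k, Continuous fun κ => traj f h γ ℓ m β x₀ (z κ) τ k := fun τ h0 k => by
    induction k with
    | zero => exact h0
    | succ k ih =>
      simp only [traj_succ]
      exact (continuous_prox hconv hprox hγ hx₀).comp
        (ih.sub ((continuous_direction hf (hz τ k) h0 ih).const_smul γ))
  induction τ generalizing k with
  | zero => exact hs 0 continuous_const k
  | succ τ ih => exact hs (τ + 1) (ih m) k

/-- `h` need not be continuous, but every iterate other than the constant `x₀` is a proximal point,
and there `continuous_toReal_prox` applies. -/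
theorem continuous_obj_traj (hf : ∀ i, Continuous (f i)) (hconv : IsConvexExt h)
    (hprox : IsProximable h) (hγ : 0 < γ) (hx₀ : h x₀ ≠ ⊤) (hm : 0 < m)
    {z : K → ℕ → ℕ → Fin b → Fin n × O d} (hz : ∀ t i j, Continuous fun κ => z κ t i j)
    (τ k : ℕ) : Continuous fun κ => (obj f h (traj f h γ ℓ m β x₀ (z κ) τ k)).toReal := by
  have hs : ∀ τ k, Continuous fun κ : K =>
      (obj f h (traj f h γ ℓ m β x₀ (z κ) τ (k + 1))).toReal := fun τ k => by
    have hc : ∀ τ k, Continuous fun κ : K => traj f h γ ℓ m β x₀ (z κ) τ k :=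
      continuous_traj hf hconv hprox hγ hx₀ hz
    simp only [toReal_obj hconv (h_traj_ne_top hprox hγ hx₀ _ _ _)]
    refine ((continuous_avg hf).comp (hc τ (k + 1))).add ?_
    simp only [traj_succ]
    exact (continuous_toReal_prox hconv hprox hγ hx₀).comp
        ((hc τ k).sub ((continuous_direction hf (hz τ k) (hc τ 0) (hc τ k)).const_smul γ))
  cases k with
  | zero =>
    cases τ with
    | zero =>
      simp only [traj_zero_zero]
      exact continuous_const
    | succ τ =>
      -- The start of an epoch is the last inner iterate of the previous one, which is a proximal
      -- point because `m > 0`.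
      obtain ⟨k, rfl⟩ := Nat.exists_eq_succ_of_ne_zero hm.ne'
      exact hs τ k
  | succ k => exact hs τ k

end Continuity

/-- Extend by a constant a family of samples indexed by `k < m` to all `k`. -/
def extendSamples {A : Type*} (a : A) (z : ℕ × Fin m × Fin b → A) (t k : ℕ) (j : Fin b) : A :=
  if hk : k < m then z (t, ⟨k, hk⟩, j) else a

theorem continuous_extendSamples {A : Type*} [TopologicalSpace A] (a : A) (t k : ℕ) (j : Fin b) :
    Continuous fun z : ℕ × Fin m × Fin b → A => extendSamples a z t k j := by
  unfold extendSamples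
  split_ifs
  · exact continuous_apply _
  · exact continuous_const

theorem continuous_fluctuation_traj (hf : ∀ i, IsLSmooth L (f i)) (hconv : IsConvexExt h)
    (hprox : IsProximable h) (hγ : 0 < γ) (hx₀ : h x₀ ≠ ⊤) (a : Fin n × O d)
    {τ k : ℕ} (hk : k < m) :
    Continuous fun z : ℕ × Fin m × Fin b → Fin n × O d => fluctuation ℓ
      (fun i => ∇ (f i) (traj f h γ ℓ m β x₀ (extendSamples a z) τ k)
        - ∇ (f i) (traj f h γ ℓ m β x₀ (extendSamples a z) τ 0)) (fun j => z (τ, ⟨k, hk⟩, j)) := by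
  have hxc : ∀ k, Continuous fun z : ℕ × Fin m × Fin b → Fin n × O d =>
      traj f h γ ℓ m β x₀ (extendSamples a z) τ k :=
    continuous_traj (fun i => (hf i).continuous) hconv hprox hγ hx₀ (continuous_extendSamples a) τ
  have hs : ∀ j : Fin b, Continuous fun z : ℕ × Fin m × Fin b → Fin n × O d =>
      z (τ, ⟨k, hk⟩, j) := fun j => continuous_apply _
  exact continuous_fluctuation_gradient (fun i => (hf i).continuous_gradient) hs (hxc 0) (hxc k)

/-- Extend by a constant a finite family of samples. -/
def fillSamples {ι A : Type*} [DecidableEq ι] (a : A) (S : Finset ι) (p : S → A) (i : ι) : A :=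
  if hi : i ∈ S then p ⟨i, hi⟩ else a

theorem continuous_fillSamples {ι A : Type*} [DecidableEq ι] [TopologicalSpace A] (a : A)
    (S : Finset ι) : Continuous (fillSamples a S) := by
  refine continuous_pi fun i => ?_
  unfold fillSamples
  split_ifs
  · exact continuous_apply _
  · exact continuous_const

/-- The indices of the samples drawn before inner step `k` of epoch `τ`. -/
def pastIndices (m b τ k : ℕ) : Finset (ℕ × Fin m × Fin b) :=
  (Finset.range (τ + 1) ×ˢ Finset.univ).filter fun i => i.1 < τ ∨ i.1 = τ ∧ i.2.1.val < k

/-- The iterate factors through finitely many past samples, as is needed to apply independence of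
disjoint finite subfamilies. -/
theorem traj_extend_fill (a : Fin n × O d) {τ k : ℕ} (hk : k ≤ m)
    (z : ℕ × Fin m × Fin b → Fin n × O d) :
    traj f h γ ℓ m β x₀ (extendSamples a (fillSamples a (pastIndices m b τ k) fun i => z i)) τ k
      = traj f h γ ℓ m β x₀ (extendSamples a z) τ k := by
  refine traj_congr hk fun t i j hi ht => ?_
  have hmem : (t, (⟨i, hi⟩ : Fin m), j) ∈ pastIndices m b τ k := by
    simp only [pastIndices, Finset.mem_filter, Finset.mem_product, Finset.mem_range,
      Finset.mem_univ, and_true]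
    omega
  simp [extendSamples, fillSamples, hi, hmem]

end Trajectory

/-! ### Expected fluctuation along the trajectory -/

section Expectation

variable {d n b m : ℕ} {f : Fin n → E d → ℝ} {h : E d → EReal} {γ L : ℝ} {ℓ : ℕ} {β : ℕ → ℝ}
  {x₀ : E d} {Ω : Type*} [MeasurableSpace Ω] {P : Measure Ω}
  {I : ℕ → ℕ → Fin b → Ω → Fin n} {G : ℕ → ℕ → Fin b → Ω → O d}

/-- The family of all samples used by the algorithm. -/
def samples (m : ℕ) (I : ℕ → ℕ → Fin b → Ω → Fin n) (G : ℕ → ℕ → Fin b → Ω → O d) (ω : Ω)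
    (p : ℕ × Fin m × Fin b) : Fin n × O d :=
  (I p.1 p.2.1 p.2.2 ω, G p.1 p.2.1 p.2.2 ω)

theorem measurable_samples (hs : IsSampling P m I G) (p : ℕ × Fin m × Fin b) :
    Measurable fun ω => samples m I G ω p :=
  (hs.measurable_index _ _ _).prodMk (hs.measurable_matrix _ _ _)

variable [IsProbabilityMeasure P]

/-- The current batch is independent of the past, which determines both iterates. With the past
frozen, the sketched vectors are fixed gradient differences, bounded by `L`-smoothness. -/
theorem integral_norm_sq_fluctuation_traj_le (hs : IsSampling P m I G) (hn : 0 < n)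
    (hb : 0 < b) (hℓ : 1 ≤ ℓ) (hℓd : ℓ ≤ d)
    (hf : ∀ i, IsLSmooth L (f i)) (hconv : IsConvexExt h)
    (hprox : IsProximable h) (hγ : 0 < γ) (hx₀ : h x₀ ≠ ⊤) (a : Fin n × O d)
    {τ k : ℕ} (hk : k < m) :
    ∫ ω, ‖fluctuation ℓ (fun i =>
        ∇ (f i) (traj f h γ ℓ m β x₀ (extendSamples a (samples m I G ω)) τ k)
          - ∇ (f i) (traj f h γ ℓ m β x₀ (extendSamples a (samples m I G ω)) τ 0))
        (fun j => samples m I G ω (τ, ⟨k, hk⟩, j))‖ ^ 2 ∂P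
      ≤ ∫ ω, (d : ℝ) / (ℓ * b) * L ^ 2 *
        ‖traj f h γ ℓ m β x₀ (extendSamples a (samples m I G ω)) τ k
          - traj f h γ ℓ m β x₀ (extendSamples a (samples m I G ω)) τ 0‖ ^ 2 ∂P := by
  have hn' : (0 : ℝ) < n := Nat.cast_pos.2 hn
  set S := pastIndices m b τ k with hS
  set T : Finset (ℕ × Fin m × Fin b) := Finset.univ.image fun j => (τ, ⟨k, hk⟩, j) with hT
  have hdisj : Disjoint S T := by
    rw [Finset.disjoint_left]
    intro i hi hiT
    simp only [hT, Finset.mem_image, Finset.mem_univ, true_and] at hiT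
    obtain ⟨j, rfl⟩ := hiT
    simp [hS, pastIndices] at hi
  have hmemT : ∀ j, (τ, (⟨k, hk⟩ : Fin m), j) ∈ T := fun j =>
    Finset.mem_image_of_mem _ (Finset.mem_univ j)
  have hYC : IndepFun (fun ω (i : S) => samples m I G ω i)
      (fun ω j => samples m I G ω (τ, ⟨k, hk⟩, j)) P :=
    (iIndepFun.indepFun_finset S T hdisj hs.indep (measurable_samples hs)).comp
      (φ := id) (ψ := fun (c : T → Fin n × O d) (j : Fin b) => c ⟨(τ, ⟨k, hk⟩, j), hmemT j⟩)
      measurable_id (measurable_pi_iff.2 fun j => measurable_pi_apply _)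
  set z : (S → Fin n × O d) → ℕ → ℕ → Fin b → Fin n × O d := fun p =>
    extendSamples a (fillSamples a S p) with hz
  have hzc : ∀ t i j, Continuous fun p => z p t i j := fun t i j =>
    (continuous_extendSamples a t i j).comp (continuous_fillSamples a S)
  have hc := fun i => continuous_traj (m := m) (ℓ := ℓ) (β := β)
    (fun i => (hf i).continuous) hconv hprox hγ hx₀ hzc τ i
  set x : (S → Fin n × O d) → E d := fun p => traj f h γ ℓ m β x₀ (z p) τ k with hx
  set y : (S → Fin n × O d) → E d := fun p => traj f h γ ℓ m β x₀ (z p) τ 0 with hy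
  have hxeq : ∀ ω, traj f h γ ℓ m β x₀ (extendSamples a (samples m I G ω)) τ k
      = x fun i => samples m I G ω i := fun ω => (traj_extend_fill a hk.le _).symm
  -- `S` contains more samples than the start of the epoch depends on, so both points are functions
  -- of the same past.
  have hyeq : ∀ ω, traj f h γ ℓ m β x₀ (extendSamples a (samples m I G ω)) τ 0
      = y fun i => samples m I G ω i := fun ω => by
    refine traj_congr (Nat.zero_le m) fun t i j hi ht => ?_
    have hmem : (t, (⟨i, hi⟩ : Fin m), j) ∈ S := by
      simp only [hS, pastIndices, Finset.mem_filter, Finset.mem_product, Finset.mem_range,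
        Finset.mem_univ, and_true]
      omega
    simp [hz, extendSamples, fillSamples, hi, hmem]
  simp only [hxeq, hyeq]
  have hYm : Measurable fun ω (i : S) => samples m I G ω i :=
    measurable_pi_iff.2 fun i => measurable_samples hs i
  have hCm : Measurable fun ω j => samples m I G ω (τ, ⟨k, hk⟩, j) :=
    measurable_pi_iff.2 fun j => measurable_samples hs _
  refine integral_comp_le_of_indepFun (P := P)
    (Φ := fun q : (S → Fin n × O d) × (Fin b → Fin n × O d) =>
      ‖fluctuation ℓ (fun i => ∇ (f i) (x q.1) - ∇ (f i) (y q.1)) q.2‖ ^ 2)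
    (ψ := fun p => (d : ℝ) / (ℓ * b) * L ^ 2 * ‖x p - y p‖ ^ 2)
    hYm hCm hYC
    ((continuous_fluctuation_gradient (fun i => (hf i).continuous_gradient)
      (fun j => (continuous_apply j).comp continuous_snd) ((hc 0).comp continuous_fst)
      ((hc k).comp continuous_fst)).norm.pow 2)
    (continuous_const.mul (((hc k).sub (hc 0)).norm.pow 2)) fun p => ?_
  have hind : iIndepFun (fun (j : Fin b) ω =>
      (I τ (⟨k, hk⟩ : Fin m) j ω, G τ (⟨k, hk⟩ : Fin m) j ω)) P :=
    hs.indep.precomp (g := fun j : Fin b => (τ, (⟨k, hk⟩ : Fin m), j))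
      fun j j' hjj => by simpa using hjj
  refine (integral_norm_sq_fluctuation_le hb hℓ hℓd
    (fun j => hs.measurable_index τ ⟨k, hk⟩ j) (fun j => hs.measurable_matrix τ ⟨k, hk⟩ j)
    (fun j => hs.indep_pair τ ⟨k, hk⟩ j) (fun j => hs.law_index τ ⟨k, hk⟩ j)
    (fun j => have := (hs.law_matrix τ ⟨k, hk⟩ j).1; inferInstance) hind
    (fun i => ∇ (f i) (x p) - ∇ (f i) (y p))).trans ?_
  rw [mul_assoc]
  refine mul_le_mul_of_nonneg_left ?_ (by positivity)
  calc (1 / (n : ℝ)) * ∑ i, ‖∇ (f i) (x p) - ∇ (f i) (y p)‖ ^ 2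
      ≤ (1 / (n : ℝ)) * ∑ _i : Fin n, (L * ‖x p - y p‖) ^ 2 := by
        gcongr with i
        exact (hf i).2 _ _
    _ = L ^ 2 * ‖x p - y p‖ ^ 2 := by
        simp only [Finset.sum_const, Finset.card_univ, Fintype.card_fin, nsmul_eq_mul]
        field_simp

end Expectation

/-! ### Stepsize arithmetic and scalar recursions -/

/-- Consequences of the stepsize restriction. -/
theorem stepsize_bounds {d b ℓ m : ℕ} (hb : 0 < b) (hℓ : 1 ≤ ℓ) (hd : 0 < d)
    (hm : 0 < m) {L μ γ α θ : ℝ} (hL : 0 < L) (hμ : 0 < μ) (hγ : 0 < γ)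
    (hα : α = 1 - γ * μ / 2) (hθ : θ = 1 - μ * γ / 2 - μ * γ * m)
    (hstep : γ < min (1 / (4 * L)) (min (2 / μ * (1 / (2 * m + 1)))
      (√(b * θ) / (10 * m * L) * √((ℓ : ℝ) / d)))) :
    4 * L * γ ≤ 1 ∧ 0 < α ∧ α < 1 ∧ 0 < θ ∧
      3 * γ / 2 * (d / (ℓ * b) * L ^ 2) ≤ 3 * θ / (200 * m ^ 2 * γ) := by
  have hb' : (0 : ℝ) < b := Nat.cast_pos.2 hb
  have hℓ' : (0 : ℝ) < ℓ := Nat.cast_pos.2 hℓ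
  have hd' : (0 : ℝ) < d := Nat.cast_pos.2 hd
  have hm' : (1 : ℝ) ≤ m := Nat.one_le_cast.2 hm
  obtain ⟨h1, h2, h3⟩ : γ < 1 / (4 * L) ∧ γ < 2 / μ * (1 / (2 * m + 1)) ∧
      γ < √(b * θ) / (10 * m * L) * √((ℓ : ℝ) / d) := by
    simpa [lt_min_iff] using hstep
  have h1' : 4 * L * γ ≤ 1 := by
    rw [lt_div_iff₀ (by positivity)] at h1
    linarith
  have h2' : μ * γ * (2 * m + 1) < 2 := by
    rw [div_mul_div_comm, mul_one, lt_div_iff₀ (by positivity)] at h2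
    linarith
  have hμγ : 0 < μ * γ := mul_pos hμ hγ
  -- Here `θ = 1 - μγ(2m+1)/2`, so positivity is the second stepsize bound.
  have hθ0 : 0 < θ := by
    rw [hθ]
    linarith
  refine ⟨h1', by rw [hα]; nlinarith, by rw [hα]; linarith, hθ0, ?_⟩
  have h4 : γ ^ 2 ≤ b * θ / (100 * m ^ 2 * L ^ 2) * (ℓ / d) := by
    have h5 := pow_le_pow_left₀ hγ.le h3.le 2
    rw [mul_pow, div_pow, Real.sq_sqrt (by positivity), Real.sq_sqrt (by positivity)] at h5
    refine h5.trans (le_of_eq ?_)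
    ring
  have h6 : γ ^ 2 * (100 * m ^ 2 * L ^ 2 * d) ≤ b * θ * ℓ := by
    rwa [div_mul_div_comm, le_div_iff₀ (by positivity)] at h4
  have e1 : 3 * γ / 2 * (d / (ℓ * b) * L ^ 2) = 3 * γ * d * L ^ 2 / (2 * (ℓ * b)) := by
    field_simp
  rw [e1, div_le_div_iff₀ (by positivity) (by positivity)]
  nlinarith

/-- The weights `c (m - k)` of the Lyapunov function are compatible with one inner step. -/
theorem lyapunov_weights {m k : ℕ} (hk : k < m) {μ γ α θ q : ℝ} (hμ : 0 < μ) (hγ : 0 < γ)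
    (hα : α = 1 - γ * μ / 2) (hθ : θ = 1 - μ * γ / 2 - μ * γ * m) (hθ0 : 0 < θ)
    (hq : q ≤ 3 * θ / (200 * m ^ 2 * γ)) :
    q + 3 / (100 * m ^ 2 * γ) * (m - (k + 1 : ℕ)) * (1 + 1 / (4 * m))
        ≤ α * (3 / (100 * m ^ 2 * γ) * (m - k)) ∧
      3 / (100 * m ^ 2 * γ) * (m - (k + 1 : ℕ)) * (1 + 4 * m) ≤ 3 / (8 * γ) := by
  have hm' : (1 : ℝ) ≤ m := by
    have : 1 ≤ m := by omega
    exact_mod_cast this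
  have hkm : (k : ℝ) + 1 ≤ m := by exact_mod_cast hk
  have hk0 : (0 : ℝ) ≤ k := Nat.cast_nonneg k
  have hm0 : (0 : ℝ) < m := by linarith
  have hμγ : 0 < μ * γ := mul_pos hμ hγ
  set c := 3 / (100 * (m : ℝ) ^ 2 * γ) with hc
  have hc0 : 0 < c := by positivity
  push_cast
  constructor
  · have h1 : q ≤ c * (θ / 2) := by
      refine hq.trans (le_of_eq ?_)
      rw [hc]
      field_simp
      norm_num
    have h2 : ((m : ℝ) - (k + 1)) * (1 + 1 / (4 * m)) = m - (k + 1) + (m - (k + 1)) / (4 * m) := by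
      ring
    have h3 : ((m : ℝ) - (k + 1)) / (4 * m) ≤ 1 / 4 := by
      rw [div_le_div_iff₀ (by positivity) (by norm_num)]
      linarith
    -- The weight drops by one: `θ/2` pays for the variance, `1/4` for Young's inequality, and the
    -- `-μγm/2` inside `θ/2` covers the loss `(γμ/2)(m - k)` caused by `α`.
    have h4 : θ / 2 + ((m : ℝ) - (k + 1)) * (1 + 1 / (4 * m)) ≤ α * (m - k) := by
      rw [h2, hα, hθ]
      nlinarith
    calc q + c * (m - (k + 1)) * (1 + 1 / (4 * m))
        ≤ c * (θ / 2) + c * (m - (k + 1)) * (1 + 1 / (4 * m)) := by linarith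
      _ = c * (θ / 2 + ((m : ℝ) - (k + 1)) * (1 + 1 / (4 * m))) := by ring
      _ ≤ c * (α * (m - k)) := by gcongr
      _ = α * (c * (m - k)) := by ring
  · calc c * (m - (k + 1)) * (1 + 4 * m) ≤ c * m * (5 * m) := by
          gcongr <;> linarith
      _ = 15 / (100 * γ) := by
          rw [hc]
          field_simp
          norm_num
      _ ≤ 3 / (8 * γ) := by
          rw [div_le_div_iff₀ (by positivity) (by positivity)]
          nlinarith

theorem norm_sub_sq_le_young {V : Type*} [SeminormedAddCommGroup V] (x y z : V) {s : ℝ}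
    (hs : 0 < s) :
    ‖x - z‖ ^ 2 ≤ (1 + 1 / s) * ‖y - z‖ ^ 2 + (1 + s) * ‖x - y‖ ^ 2 := by
  have h1 : ‖x - z‖ ≤ ‖x - y‖ + ‖y - z‖ := norm_sub_le_norm_sub_add_norm_sub x y z
  have h2 : ‖x - z‖ ^ 2 ≤ (‖x - y‖ + ‖y - z‖) ^ 2 := by gcongr
  have h3 : (1 + 1 / s) * ‖y - z‖ ^ 2 + (1 + s) * ‖x - y‖ ^ 2 - (‖x - y‖ + ‖y - z‖) ^ 2
      = 1 / s * (‖y - z‖ - s * ‖x - y‖) ^ 2 := by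
    field_simp
    ring
  have h4 : 0 ≤ 1 / s * (‖y - z‖ - s * ‖x - y‖) ^ 2 := by positivity
  linarith

theorem le_geometric_of_step {V : ℕ → ℝ} {α B : ℝ} (hα0 : 0 ≤ α) (hα1 : α < 1) {m : ℕ}
    (hV : ∀ k < m, V (k + 1) ≤ α * V k + B) :
    V m ≤ α ^ m * V 0 + (1 - α ^ m) / (1 - α) * B := by
  have hα' : 1 - α ≠ 0 := (sub_pos.2 hα1).ne'
  suffices h : ∀ k ≤ m, V k ≤ α ^ k * V 0 + (1 - α ^ k) / (1 - α) * B from h m le_rfl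
  intro k
  induction k with
  | zero => simp
  | succ k ih =>
    intro hk
    refine (hV k hk).trans ?_
    have h1 := mul_le_mul_of_nonneg_left (ih (Nat.le_of_succ_le hk)) hα0
    have h2 : α * (α ^ k * V 0 + (1 - α ^ k) / (1 - α) * B) + B
        = α ^ (k + 1) * V 0 + (1 - α ^ (k + 1)) / (1 - α) * B := by
      field_simp
      ring
    linarith

/-- Dividing the recursion by `α ^ (m * (τ + 1))` makes it telescope, hence the weights in the sum.
-/
theorem le_of_epoch_step {a δ : ℕ → ℝ} {α C : ℝ} (hα : 0 < α) {m : ℕ}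
    (ha : ∀ τ, a (τ + 1) ≤ α ^ m * a τ + C * δ τ) (τ : ℕ) :
    a τ ≤ α ^ (m * τ) * (a 0 + C * ∑ i ∈ Finset.range τ, δ i / α ^ (m * (i + 1))) := by
  induction τ with
  | zero => simp
  | succ τ ih =>
    refine (ha τ).trans ?_
    have h1 := mul_le_mul_of_nonneg_left ih (pow_nonneg hα.le m)
    have h2 : α ^ (m * (τ + 1)) * (δ τ / α ^ (m * (τ + 1))) = δ τ :=
      mul_div_cancel₀ _ (pow_pos hα _).ne'
    have h3 : α ^ (m * (τ + 1)) = α ^ m * α ^ (m * τ) := by ring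
    rw [Finset.sum_range_succ, mul_add C, ← add_assoc, mul_add, mul_left_comm _ C, h2, h3,
      mul_assoc]
    linarith

theorem integral_affine_combination {Ω : Type*} [MeasurableSpace Ω] {P : Measure Ω}
    [IsProbabilityMeasure P] {u v w : Ω → ℝ} (hu : Integrable u P) (hv : Integrable v P)
    (hw : Integrable w P) (r s t B : ℝ) :
    ∫ ω, (r * u ω + s * v ω + t * w ω + B) ∂P
      = r * ∫ ω, u ω ∂P + s * ∫ ω, v ω ∂P + t * ∫ ω, w ω ∂P + B := by
  have h1 : Integrable (fun ω => r * u ω) P := hu.const_mul r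
  have h2 : Integrable (fun ω => s * v ω) P := hv.const_mul s
  have h3 : Integrable (fun ω => t * w ω) P := hw.const_mul t
  have h12 : Integrable (fun ω => r * u ω + s * v ω) P := h1.add h2
  have h123 : Integrable (fun ω => r * u ω + s * v ω + t * w ω) P := h12.add h3
  rw [integral_add h123 (integrable_const B), integral_add h12 h3, integral_add h1 h2]
  simp [integral_const_mul]

/-! ### Lyapunov descent within an epoch -/

section Epoch

variable {d n b m : ℕ} {f : Fin n → E d → ℝ} {h : E d → EReal} {γ L μ α θ : ℝ} {ℓ : ℕ}
  {β : ℕ → ℝ} {x₀ : E d} {Ω : Type*} [MeasurableSpace Ω] {P : Measure Ω}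
  [IsProbabilityMeasure P] {I : ℕ → ℕ → Fin b → Ω → Fin n} {G : ℕ → ℕ → Fin b → Ω → O d}

theorem integral_lyapunov_step_le (hs : IsSampling P m I G) (hn : 0 < n) (hb : 0 < b)
    (hℓ : 1 ≤ ℓ) (hℓd : ℓ ≤ d) (hL : 0 < L) (hμ : 0 < μ) (hγ : 0 < γ)
    (hsmooth : ∀ i, IsLSmooth L (f i)) (hconv : IsConvexExt h) (hprox : IsProximable h)
    (hRPL : IsRPL f h γ μ) (hα : α = 1 - γ * μ / 2) (hθ : θ = 1 - μ * γ / 2 - μ * γ * m)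
    (hstep : γ < min (1 / (4 * L)) (min (2 / μ * (1 / (2 * m + 1)))
      (√(b * θ) / (10 * m * L) * √((ℓ : ℝ) / d))))
    (hβ : ∀ τ, 0 < β τ) (hx₀ : h x₀ ≠ ⊤) (a : Fin n × O d) (τ : ℕ) {k : ℕ} (hk : k < m)
    {x : ℕ → Ω → E d}
    (hx : x = fun k ω => traj f h γ ℓ m β x₀ (extendSamples a (samples m I G ω)) τ k)
    {V : ℕ → ℝ} (hV : V = fun k : ℕ => ∫ ω, ((obj f h (x k ω)).toReal - minObj f h
      + 3 / (100 * m ^ 2 * γ) * (m - k) * ‖x k ω - x 0 ω‖ ^ 2) ∂P) :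
    V (k + 1) ≤ α * V k + γ * (3 * L ^ 2 * d ^ 2 / ℓ + L ^ 2 * d / 2) * β τ ^ 2 := by
  have hm : 0 < m := by omega
  obtain ⟨hγL, -, -, hθ0, hq⟩ := stepsize_bounds hb hℓ (by omega) hm hL hμ hγ hα hθ hstep
  obtain ⟨hw1, hw2⟩ := lyapunov_weights hk hμ hγ hα hθ hθ0 hq
  set c := 3 / (100 * (m : ℝ) ^ 2 * γ) with hc
  set q := 3 * γ / 2 * (d / (ℓ * b) * L ^ 2) with hqdef
  set B := γ * (3 * L ^ 2 * d ^ 2 / ℓ + L ^ 2 * d / 2) * β τ ^ 2 with hB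
  have hfc := fun i => (hsmooth i).continuous
  have hZ : Measurable fun ω => samples m I G ω :=
    measurable_pi_iff.2 fun p => measurable_samples hs p
  have hext : ∀ t i j, Continuous fun z : ℕ × Fin m × Fin b → Fin n × O d =>
      extendSamples a z t i j := continuous_extendSamples a
  have hxc : ∀ k, Continuous fun z : ℕ × Fin m × Fin b → Fin n × O d =>
      traj f h γ ℓ m β x₀ (extendSamples a z) τ k :=
    continuous_traj hfc hconv hprox hγ hx₀ hext τ
  have hobj : ∀ k, Integrable (fun ω => (obj f h (x k ω)).toReal - minObj f h) P := fun k => by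
    rw [hx]
    exact integrable_comp_of_continuous_compact hZ
      ((continuous_obj_traj hfc hconv hprox hγ hx₀ hm hext τ k).sub continuous_const)
  have hdist : ∀ k, Integrable (fun ω => ‖x k ω - x 0 ω‖ ^ 2) P := fun k => by
    rw [hx]
    exact integrable_comp_of_continuous_compact hZ (((hxc k).sub (hxc 0)).norm.pow 2)
  have h2int : ∀ k, Integrable (fun ω => c * (m - k) * ‖x k ω - x 0 ω‖ ^ 2) P :=
    fun k => (hdist k).const_mul _
  set φ : Ω → ℝ := fun ω => ‖fluctuation ℓ (fun i => ∇ (f i) (x k ω) - ∇ (f i) (x 0 ω))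
    (fun j => samples m I G ω (τ, ⟨k, hk⟩, j))‖ ^ 2 with hφ
  have hφint : Integrable φ P := by
    rw [hφ, hx]
    exact integrable_comp_of_continuous_compact hZ
      ((continuous_fluctuation_traj hsmooth hconv hprox hγ hx₀ a hk).norm.pow 2)
  have hφle : ∫ ω, φ ω ∂P ≤ d / (ℓ * b) * L ^ 2 * ∫ ω, ‖x k ω - x 0 ω‖ ^ 2 ∂P := by
    rw [← integral_const_mul, hφ, hx]
    exact integral_norm_sq_fluctuation_traj_le hs hn hb hℓ hℓd hsmooth hconv hprox hγ hx₀
      a hk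
  have hpath : ∀ ω, (obj f h (x (k + 1) ω)).toReal - minObj f h
        + c * (m - (k + 1 : ℕ)) * ‖x (k + 1) ω - x 0 ω‖ ^ 2
      ≤ α * ((obj f h (x k ω)).toReal - minObj f h) + 3 * γ / 2 * φ ω
        + c * (m - (k + 1 : ℕ)) * (1 + 1 / (4 * m)) * ‖x k ω - x 0 ω‖ ^ 2 + B := fun ω => by
    have hxk : x (k + 1) ω = prox h γ (x k ω - γ • direction f ℓ (β τ)
        (fun j => (samples m I G ω (τ, ⟨k, hk⟩, j)).1)
        (fun j => (samples m I G ω (τ, ⟨k, hk⟩, j)).2) (x 0 ω) (x k ω)) := by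
      rw [hx]
      simp only [traj_succ]
      simp [extendSamples, hk]
    have h1 := gap_prox_le (IsLSmooth.avg hn hsmooth) hconv hprox hγ hγL hRPL
      (x := x k ω) (by rw [hx]; exact h_traj_ne_top hprox hγ hx₀ _ _ _)
      (direction f ℓ (β τ) (fun j => (samples m I G ω (τ, ⟨k, hk⟩, j)).1)
        (fun j => (samples m I G ω (τ, ⟨k, hk⟩, j)).2) (x 0 ω) (x k ω))
    rw [← hxk, ← hα] at h1
    have h2 := norm_sq_gradient_sub_direction_le hn hb hsmooth hL.le hℓ hℓd (hβ τ)
      (fun j => samples m I G ω (τ, ⟨k, hk⟩, j)) (x 0 ω) (x k ω)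
    have h3 := mul_le_mul_of_nonneg_left h2 (by positivity : 0 ≤ γ / 2)
    have hm' : (0 : ℝ) < m := Nat.cast_pos.2 hm
    -- The parameter `4m` keeps the growth factor at `1 + 1/(4m)`, so a weight of at most `m` grows
    -- by at most `1/4`; the price `1 + 4m` on the last displacement is absorbed by the gain
    -- `3/(8γ)`.
    have h4 := norm_sub_sq_le_young (x (k + 1) ω) (x k ω) (x 0 ω)
      (by positivity : (0 : ℝ) < 4 * m)
    have hkm : ((k + 1 : ℕ) : ℝ) ≤ m := by exact_mod_cast hk
    have h5 := mul_le_mul_of_nonneg_left h4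
      (mul_nonneg (by positivity : 0 ≤ c) (sub_nonneg.2 hkm))
    have h6 := mul_le_mul_of_nonneg_right hw2 (sq_nonneg ‖x (k + 1) ω - x k ω‖)
    have h7 : γ / 2 * (3 * φ ω + (6 * L ^ 2 * d ^ 2 / ℓ + L ^ 2 * d) * β τ ^ 2)
        = 3 * γ / 2 * φ ω + B := by
      rw [hB]
      ring
    rw [h7] at h3
    linarith
  rw [hV]
  calc ∫ ω, ((obj f h (x (k + 1) ω)).toReal - minObj f h
        + c * (m - (k + 1 : ℕ)) * ‖x (k + 1) ω - x 0 ω‖ ^ 2) ∂P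
      ≤ ∫ ω, (α * ((obj f h (x k ω)).toReal - minObj f h) + 3 * γ / 2 * φ ω
        + c * (m - (k + 1 : ℕ)) * (1 + 1 / (4 * m)) * ‖x k ω - x 0 ω‖ ^ 2 + B) ∂P :=
        integral_mono ((hobj (k + 1)).add ((hdist (k + 1)).const_mul _))
          (((((hobj k).const_mul α).add (hφint.const_mul _)).add
            ((hdist k).const_mul _)).add (integrable_const B)) hpath
    _ = α * ∫ ω, ((obj f h (x k ω)).toReal - minObj f h) ∂P + 3 * γ / 2 * ∫ ω, φ ω ∂P
        + c * (m - (k + 1 : ℕ)) * (1 + 1 / (4 * m)) * ∫ ω, ‖x k ω - x 0 ω‖ ^ 2 ∂P + B := by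
        exact integral_affine_combination (hobj k) hφint (hdist k) _ _ _ B
    _ ≤ α * (∫ ω, ((obj f h (x k ω)).toReal - minObj f h) ∂P
        + c * (m - k) * ∫ ω, ‖x k ω - x 0 ω‖ ^ 2 ∂P) + B := by
        have h0 : 0 ≤ ∫ ω, ‖x k ω - x 0 ω‖ ^ 2 ∂P := integral_nonneg fun ω => sq_nonneg _
        have h1 := mul_le_mul_of_nonneg_left hφle (by positivity : 0 ≤ 3 * γ / 2)
        have h2 := mul_le_mul_of_nonneg_right hw1 h0
        rw [hqdef] at h2
        linarith
    _ = _ := by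
        beta_reduce
        rw [integral_add (hobj k) (h2int k), integral_const_mul]

end Epoch

end VRSZD

/-! ### The convergence theorem -/

open VRSZD

theorem theorem2 {Ω : Type*} [MeasurableSpace Ω] (P : Measure Ω) [IsProbabilityMeasure P]
    (d n b ℓ m : ℕ) (hn : 0 < n) (hb : 0 < b) (hℓ : 1 ≤ ℓ) (hℓd : ℓ ≤ d) (hm : 0 < m)
    (f : Fin n → E d → ℝ) (h : E d → EReal)
    (L μ γ α θ : ℝ) (hL : 0 < L) (hμ : 0 < μ) (hγ : 0 < γ)
    (hsmooth : ∀ i, IsLSmooth L (f i))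
    (hconv : IsConvexExt h) (hprox : IsProximable h)
    (hmin : ∃ z, ∀ x, obj f h z ≤ obj f h x)
    (hRPL : IsRPL f h γ μ)
    (hα : α = 1 - γ * μ / 2)
    (hθ : θ = 1 - μ * γ / 2 - μ * γ * m)
    (hstep : γ < min (1 / (4 * L)) (min (2 / μ * (1 / (2 * m + 1)))
      (√(b * θ) / (10 * m * L) * √((ℓ : ℝ) / d))))
    (β : ℕ → ℝ) (hβ : ∀ τ, 0 < β τ)
    (x₀ : E d) (hx₀ : h x₀ ≠ ⊤)
    (I : ℕ → ℕ → Fin b → Ω → Fin n) (G : ℕ → ℕ → Fin b → Ω → O d)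
    (hsample : IsSampling P m I G)
    (X : ℕ → Ω → E d)
    (hX : ∀ τ ω, X τ ω = outerIter f h γ ℓ m β (fun t k j => I t k j ω)
      (fun t k j => G t k j ω) x₀ τ) (τ : ℕ) :
    (∀ ω, obj f h (X (τ + 1) ω) ≠ ⊤) ∧
    Integrable (fun ω => (obj f h (X (τ + 1) ω)).toReal - minObj f h) P ∧
    ∫ ω, ((obj f h (X (τ + 1) ω)).toReal - minObj f h) ∂P
      ≤ α ^ (m * (τ + 1)) * (((obj f h x₀).toReal - minObj f h)
        + (1 - α ^ m) / (1 - α) * γ * (3 * L ^ 2 * d ^ 2 / ℓ + L ^ 2 * d / 2)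
          * ∑ i ∈ Finset.range (τ + 1), β i ^ 2 / α ^ (m * (i + 1))) := by
  set a : Fin n × O d := (⟨0, hn⟩, 1) with ha
  obtain ⟨-, hα0, hα1, -, -⟩ := stepsize_bounds hb hℓ (by omega) hm hL hμ hγ hα hθ hstep
  have hXtraj : ∀ t ω, X t ω = traj f h γ ℓ m β x₀ (extendSamples a (samples m I G ω)) t 0 :=
    fun t ω => by
      rw [hX]
      exact traj_congr (z := fun t k j => (I t k j ω, G t k j ω)) (Nat.zero_le m)
        fun t i j hi _ => by simp [extendSamples, samples, hi]
  have hfin : ∀ t ω, h (X t ω) ≠ ⊤ := fun t ω => by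
    rw [hXtraj]
    exact h_traj_ne_top hprox hγ hx₀ _ _ _
  have hstepτ : ∀ t, ∫ ω, ((obj f h (X (t + 1) ω)).toReal - minObj f h) ∂P
      ≤ α ^ m * ∫ ω, ((obj f h (X t ω)).toReal - minObj f h) ∂P
        + (1 - α ^ m) / (1 - α) * γ * (3 * L ^ 2 * d ^ 2 / ℓ + L ^ 2 * d / 2) * β t ^ 2 := by
    intro t
    have h1 := le_geometric_of_step hα0.le hα1 fun k hk =>
      integral_lyapunov_step_le hsample hn hb hℓ hℓd hL hμ hγ hsmooth hconv hprox hRPL hα hθ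
        hstep hβ hx₀ a t hk rfl rfl
    -- The distance term disappears at both ends: its weight is zero at `k = m`, the distance is
    -- zero at `k = 0`.
    simp only [← hXtraj, ← traj_succ_zero, sub_self, norm_zero, mul_zero, zero_mul, add_zero,
      ne_eq, OfNat.ofNat_ne_zero, not_false_eq_true, zero_pow] at h1
    refine h1.trans (le_of_eq ?_)
    ring
  refine ⟨fun ω => obj_ne_top (hfin _ ω), ?_, ?_⟩
  · simp only [hXtraj]
    exact integrable_comp_of_continuous_compact
      (measurable_pi_iff.2 fun p => measurable_samples hsample p)
      ((continuous_obj_traj (fun i => (hsmooth i).continuous) hconv hprox hγ hx₀ hm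
        (continuous_extendSamples a) (τ + 1) 0).sub continuous_const)
  · have h1 := le_of_epoch_step
      (a := fun t => ∫ ω, ((obj f h (X t ω)).toReal - minObj f h) ∂P) (δ := fun t => β t ^ 2)
      hα0 hstepτ (τ + 1)
    have h0 : ∀ ω, X 0 ω = x₀ := fun ω => by rw [hX]; rfl
    simpa [h0] using h1
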